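/- Let $d\ge 1$, let $\Sigma_p\neq\Sigma_q$ be positive definite $d\times d$ matrices, and let $\mathcal P=\{P_\mu=N(\mu,\Sigma_p):\mu\in\mathbb R^d\}$ (null) and $\mathcal Q=\{Q_\mu=N(\mu,\Sigma_q):\mu\in\mathbb R^d\}$ (alternative) be the two Gaussian location families, with Lebesgue densities $p_\mu,q_\mu$, extended to samples $U^n=(U_1,\dots,U_n)$ by the i.i.d. assumption. Fix $\mu^*\in\mathbb R^d$, $n_0>0$, $x_0\in\mathbb R^d$ and a prior $W_1=N(\mu_1,\Pi_1)$ with $\Pi_1$ positive definite. Put $$\breve\mu_{|k}=\frac{n_0x_0+\sum_{i=1}^kU_i}{k+n_0},\qquad q_{W_1}(U^n)=\int q_\mu(U^n)\,dW_1(\mu),\qquad Z=n^{-1/2}\sum_{i=1}^nU_i,\qquad d_{qp}=\operatorname{tr}(\Sigma_q\Sigma_p^{-1}).$$ The reverse information projection (RIPr) $p_{\leftsquigarrow q}$ of a distribution $Q$ with density $q$ onto a convex set $\mathcal C$ of distributions (with $\inf_{P\in\mathcal C}D(Q\|P)<\infty$) is the $Q$-a.s. unique sub-probability density such that $\log p_j\to\log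 p_{\leftsquigarrow q}$ in $L^1(Q)$ for every sequence $P_j\in\mathcal C$, with densities $p_j$, satisfying $D(Q\|P_j)\to\inf_{P\in\mathcal C}D(Q\|P)$. Define $$S^{(n)}_{\breve\mu,\mathrm{UI}}=\frac{\prod_{i=1}^nq_{\breve\mu_{|i-1}}(U_i)}{\sup_\mu p_\mu(U^n)},\qquad S^{(n)}_{W_1,\mathrm{UI}}=\frac{q_{W_1}(U^n)}{\sup_\mu p_\mu(U^n)},\qquad S^{(n)}_{\mathrm{COND}}=\frac{q(U^n\mid Z)}{p(U^n\mid Z)},$$ $$S^{(n)}_{\breve\mu,\text{seq-rip}}=\prod_{i=1}^n\frac{q_{\breve\mu_{|i-1}}(U_i)}{p_{\leftsquigarrow q_{\breve\mu_{|i-1}}}(U_i)},\qquad S^{(n)}_{W_1,\mathrm{rip}}=\frac{q_{W_1}(U^n)}{p_{\leftsquigarrow q_{W_1}}(U^n)}.$$ Here $p(\cdot\mid Z)$ and $q(\cdot\mid Z)$ are the densities, relative to a common measure, of the regular conditional distributions of $U^n$ given $Z$ under $\mathcal P$ and $\mathcal Q$; these do not depend on the mean, since $Z$ is sufficient. In $S_{\text{seq-rip}}$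 the RIPr is onto the convex hull of $\{P_\mu(U_1)\}_\mu$ (with versions jointly measurable in the past and the outcome), and in $S_{W_1,\mathrm{rip}}$ it is onto the convex hull of $\{P_\mu(U^n)\}_\mu$. Let $\mathbb E$ denote expectation under $U_1,U_2,\dots$ i.i.d. $\sim Q_{\mu^*}$; $O(1)$ is as $n\to\infty$. All expectations below exist and are finite, and: 1. There is $\epsilon>0$ such that $\mathbb E[\log S^{(n)}_{\mathrm{COND}}]>n\epsilon$ for all $n>1$. 2. $\mathbb E[\log (S^{(n)}_{W_1,\mathrm{UI}}/S^{(n)}_{\breve\mu,\mathrm{UI}})]=O(1)$. 3. $\mathbb E[\log (S^{(n)}_{\mathrm{COND}}/S^{(n)}_{\breve\mu,\mathrm{UI}})]=\frac d2\log n+O(1)$. 4. In the simple case ($\Sigma_q-\Sigma_p$ negative semidefinite) the RIPrs in $S_{\text{seq-rip}}$ exist, $\mathbb E[\log (S^{(n)}_{\breve\mu,\text{seq-rip}}/S^{(n)}_{\breve\mu,\mathrm{UI}})]=\frac{d_{qp}}2\log n+O(1)$, and $d_{qp}\le d$; in the strict simple case ($\Sigma_q-\Sigma_p$ negative definite), $d_{qp}<d$.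 5. In the anti-simple case ($\Sigma_q-\Sigma_p$ positive semidefinite) the RIPrs in $S_{\text{seq-rip}}$ and $S_{W_1,\mathrm{rip}}$ exist, and for all $n\ge1$: $\mathbb E[\log S^{(n)}_{\breve\mu,\text{seq-rip}}]=0$, $S^{(n)}_{W_1,\mathrm{rip}}=S^{(n)}_{\mathrm{COND}}$ almost surely, and $\mathbb E[\log (S^{(n)}_{W_1,\mathrm{rip}}/S^{(n)}_{\mathrm{COND}})]=0$. -/

import Mathlib

open MeasureTheory ProbabilityTheory InformationTheory Filter Topology
open scoped ENNReal Matrix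

namespace GaussTest

noncomputable section

/-- A single outcome `U = X` takes values in `ℝ^d`. -/
abbrev Obs (d : ℕ) : Type := EuclideanSpace ℝ (Fin d)

/-- A sample `U^n = (U_1, …, U_n)`; the entry `U_{i+1}` has index `i : Fin n`. -/
abbrev Sample (d n : ℕ) : Type := Fin n → Obs d

/-- The Lebesgue density of the Gaussian distribution `N(m, S)` on `ℝ^d`. -/
def gaussDensity {d : ℕ} (S : Matrix (Fin d) (Fin d) ℝ) (m x : Obs d) : ℝ :=
  (Real.sqrt ((2 * Real.pi) ^ d * S.det))⁻¹ *
    Real.exp (-(1 / 2) * ((x - m).ofLp ⬝ᵥ (S⁻¹ *ᵥ (x - m).ofLp)))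

/-- The law of an i.i.d. sample of size `n` from `N(m, S)`. -/
def iidLaw {d : ℕ} (S : Matrix (Fin d) (Fin d) ℝ) (m : Obs d) (n : ℕ) :
    Measure (Sample d n) :=
  Measure.pi fun _ => multivariateGaussian m S

instance {d : ℕ} (S : Matrix (Fin d) (Fin d) ℝ) (m : Obs d) (n : ℕ) :
    IsProbabilityMeasure (iidLaw S m n) := by
  unfold iidLaw; infer_instance

/-- The density of an i.i.d. sample of size `n` from `N(m, S)`. -/
def iidDensity {d n : ℕ} (S : Matrix (Fin d) (Fin d) ℝ) (m : Obs d) (u : Sample d n) : ℝ :=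
  ∏ i, gaussDensity S m (u i)

/-- The Bayes marginal density of a sample from the location family with covariance `S`,
for the prior `N(m₁, C)` on the mean. -/
def bayesDensity {d n : ℕ} (S : Matrix (Fin d) (Fin d) ℝ) (m₁ : Obs d)
    (C : Matrix (Fin d) (Fin d) ℝ) (u : Sample d n) : ℝ :=
  ∫ m, iidDensity S m u ∂(multivariateGaussian m₁ C)

/-- The regularized maximum likelihood estimator `(n₀ x₀ + ∑ x_i) / (k + n₀)` from `k` outcomes. -/
def plugIn {d k : ℕ} (n₀ : ℝ) (x₀ : Obs d) (past : Sample d k) : Obs d :=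
  ((k : ℝ) + n₀)⁻¹ • (n₀ • x₀ + ∑ j, past j)

/-- The part `U^i` of the sample that precedes the entry of index `i`. -/
def pastOf {d n : ℕ} (u : Sample d n) (i : Fin n) : Sample d i :=
  fun j => u (j.castLE i.isLt.le)

/-- The prequential plug-in density `∏ q_{μ̆_{i-1}}(U_i)`. -/
def plugInDensity {d n : ℕ} (S : Matrix (Fin d) (Fin d) ℝ) (n₀ : ℝ) (x₀ : Obs d)
    (u : Sample d n) : ℝ :=
  ∏ i, gaussDensity S (plugIn n₀ x₀ (pastOf u i)) (u i)

/-- The maximized likelihood of the sample under the null, `sup_μ p_μ(U^n)`. -/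
def maxLikelihood {d n : ℕ} (Sp : Matrix (Fin d) (Fin d) ℝ) (u : Sample d n) : ℝ :=
  ⨆ m : Obs d, iidDensity Sp m u

/-- The universal inference statistic with a plug-in numerator. -/
def plugInUI {d n : ℕ} (Sp Sq : Matrix (Fin d) (Fin d) ℝ) (n₀ : ℝ) (x₀ : Obs d)
    (u : Sample d n) : ℝ :=
  plugInDensity Sq n₀ x₀ u / maxLikelihood Sp u

/-- The universal inference statistic with a Bayes numerator for the prior `N(m₁, C)`. -/
def bayesUI {d n : ℕ} (Sp Sq : Matrix (Fin d) (Fin d) ℝ) (m₁ : Obs d)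
    (C : Matrix (Fin d) (Fin d) ℝ) (u : Sample d n) : ℝ :=
  bayesDensity Sq m₁ C u / maxLikelihood Sp u

/-- The sufficient statistic `Z = n^{-1/2} ∑ X_i`. -/
def suffStat {d n : ℕ} (u : Sample d n) : Obs d :=
  (Real.sqrt n)⁻¹ • ∑ i, u i

/-- The regular conditional distribution of `U^n` given `Z`, in the location family with
covariance `S`, computed from the member with mean `m`. -/
def condLaw {d : ℕ} (S : Matrix (Fin d) (Fin d) ℝ) (m : Obs d) (n : ℕ) :
    Kernel (Obs d) (Sample d n) :=
  condDistrib (fun u : Sample d n => u) suffStat (iidLaw S m n)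

instance {d : ℕ} (S : Matrix (Fin d) (Fin d) ℝ) (m : Obs d) (n : ℕ) :
    IsMarkovKernel (condLaw S m n) := by
  unfold condLaw; infer_instance

/-- The conditional statistic `q(U^n ∣ Z) / p(U^n ∣ Z)`. Both conditional densities are taken
relative to the sum of the two conditional distributions. The conditional distributions are
computed from the members with means `a` (null) and `b` (alternative); by sufficiency of `Z` the
choice of `a` and `b` is immaterial. -/
def condStat {d n : ℕ} (Sp Sq : Matrix (Fin d) (Fin d) ℝ) (a b : Obs d) (u : Sample d n) : ℝ :=
  (Kernel.rnDeriv (condLaw Sq b n) (condLaw Sp a n + condLaw Sq b n) (suffStat u) u /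
    Kernel.rnDeriv (condLaw Sp a n) (condLaw Sp a n + condLaw Sq b n) (suffStat u) u).toReal

/-- The measure with density `f` relative to `ν`. -/
def ofDensity {α : Type*} [MeasurableSpace α] (ν : Measure α) (f : α → ℝ) : Measure α :=
  ν.withDensity fun x => ENNReal.ofReal (f x)

/-- The density `p` (relative to `ν`) is a version of the reverse information projection of the
distribution `Q` with density `q` onto the convex hull of the set `𝓕` of densities (for `q` with a
finite Kullback-Leibler divergence to that hull): it is a sub-probability density, positive
`Q`-almost surely, such that `log f_j → log p` in `L¹(Q)` for every sequence `f_j` in the hull whose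
Kullback-Leibler divergences `D(Q ‖ f_j)` tend to their infimum over the hull. This determines `p`
up to `Q`-null sets. -/
structure IsRIPr {α : Type*} [MeasurableSpace α] (ν : Measure α) (q : α → ℝ)
    (𝓕 : Set (α → ℝ)) (p : α → ℝ) : Prop where
  measurable : Measurable p
  nonneg : ∀ x, 0 ≤ p x
  pos : ∀ᵐ x ∂(ofDensity ν q), 0 < p x
  lintegral_le_one : ∫⁻ x, ENNReal.ofReal (p x) ∂ν ≤ 1
  tendsto_log : ∀ f : ℕ → α → ℝ, (∀ j, f j ∈ convexHull ℝ 𝓕) →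
    Tendsto (fun j => klDiv (ofDensity ν q) (ofDensity ν (f j))) atTop
      (𝓝 (⨅ g ∈ convexHull ℝ 𝓕, klDiv (ofDensity ν q) (ofDensity ν g))) →
    Tendsto (fun j => ∫⁻ x, ‖Real.log (f j x) - Real.log (p x)‖ₑ ∂(ofDensity ν q)) atTop (𝓝 0)

/-- The null `𝒫(U^n)` as a set of densities on samples of size `n`. -/
def nullDensities {d : ℕ} (Sp : Matrix (Fin d) (Fin d) ℝ) (n : ℕ) : Set (Sample d n → ℝ) :=
  Set.range fun m u => iidDensity Sp m u

/-- The null `𝒫(U)` as a set of densities of a single outcome. -/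
def nullDensities₁ {d : ℕ} (Sp : Matrix (Fin d) (Fin d) ℝ) : Set (Obs d → ℝ) :=
  Set.range fun m x => gaussDensity Sp m x

/-- `p` is a version of the reverse information projection of the Bayes marginal `Q_{W₁}(U^n)`,
`W₁ = N(m₁, C)`, onto the convex hull of `𝒫(U^n)`. -/
def IsBayesRIPr {d n : ℕ} (Sp Sq : Matrix (Fin d) (Fin d) ℝ) (m₁ : Obs d)
    (C : Matrix (Fin d) (Fin d) ℝ) (p : Sample d n → ℝ) : Prop :=
  IsRIPr volume (fun u : Sample d n => bayesDensity Sq m₁ C u) (nullDensities Sp n) p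

/-- The statistic `q_{W₁}(U^n) / p(U^n)`, for `p` the reverse information projection. -/
def bayesRIP {d n : ℕ} (Sq : Matrix (Fin d) (Fin d) ℝ) (m₁ : Obs d)
    (C : Matrix (Fin d) (Fin d) ℝ) (p : Sample d n → ℝ) (u : Sample d n) : ℝ :=
  bayesDensity Sq m₁ C u / p u

/-- `p k past` is, for each past of `k` outcomes, a version of the local reverse information
projection of the plug-in predictive distribution of the next outcome onto the convex hull of
`𝒫(U)`; the versions are chosen jointly measurably. -/
def IsSeqRIPr {d : ℕ} (Sp Sq : Matrix (Fin d) (Fin d) ℝ) (n₀ : ℝ) (x₀ : Obs d)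
    (p : (k : ℕ) → Sample d k → Obs d → ℝ) : Prop :=
  ∀ k, Measurable (fun z : Sample d k × Obs d => p k z.1 z.2) ∧
    ∀ past : Sample d k,
      IsRIPr volume (gaussDensity Sq (plugIn n₀ x₀ past)) (nullDensities₁ Sp) (p k past)

/-- The sequential statistic `∏ q_{μ̆_{i-1}}(U_i) / p(U_i)`, for `p` the local reverse information
projections. -/
def seqRIP {d n : ℕ} (Sq : Matrix (Fin d) (Fin d) ℝ) (n₀ : ℝ) (x₀ : Obs d)
    (p : (k : ℕ) → Sample d k → Obs d → ℝ) (u : Sample d n) : ℝ :=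
  ∏ i, gaussDensity Sq (plugIn n₀ x₀ (pastOf u i)) (u i) / p i (pastOf u i) (u i)

/-- The effective dimension `d_{ab} = tr(Σ_a Σ_b⁻¹)`. -/
def effDim {d : ℕ} (Sa Sb : Matrix (Fin d) (Fin d) ℝ) : ℝ :=
  (Sa * Sb⁻¹).trace

end

end GaussTest

/-! ### The Lebesgue density of a multivariate Gaussian. -/

namespace GaussTest

variable {d n : ℕ} {S : Matrix (Fin d) (Fin d) ℝ}

/-! Everything rests on sufficiency. The likelihood splits as `condFactor S u` times the density of
N(√n m, S) at Z (`iidDensity_eq_condFactor_mul`), and the first factor does not involve the mean.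
Hence the maximized likelihood is `condFactor` times the modal value of a Gaussian density
(`maxLikelihood_eq`), the Bayes marginal is `condFactor` times the density of N(√n m₁, S + nC) at Z
(`bayesDensity_ae_eq`), and the conditional statistic is the ratio of the two factors
(`condStat_ae_eq`).

For data with covariance T, the mean of log `condFactor` is (n - 1) `meanLogLik T S`. The plug-in
log-likelihood has mean n `meanLogLik T S` minus half the accumulated prediction error of the
estimator. Its variance part is tr(T S⁻¹) ∑ k/(k + n₀)² = tr(T S⁻¹) log n + O(1), and its bias part
is summable. So the gap between the two is (tr(T S⁻¹)/2) log n + O(1)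
(`isBigO_integral_condFactor_sub_plugIn`). Taking S = T = Σ_q gives d/2; S = Σ_p, T = Σ_q gives
d_qp/2. The Gaussian factor of the Bayes marginal contributes -(d/2) log n, which cancels against
d/2. Linear growth of the conditional statistic is positivity of a Kullback-Leibler divergence.

Projections are identified by a criterion (`isRIPr_of_lintegral_div_le_one`): p is the projection if
E_Q[f/p] ≤ 1 on the family and the hull comes as close to Q as p does. In the simple case p is the
null element with the same mean. In the anti-simple case Q is itself a Gaussian mixture of null
elements, so p = q; for the Bayes marginal, p is the null's Bayes marginal under a prior whose
covariance is enlarged by (Σ_q - Σ_p)/n, which gives Z the same law under both, so that q/p is the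
conditional statistic. Finite mixtures reach these continuous mixtures in divergence by dominated
convergence (`iInf_klDiv_le_mixture`). Uniqueness (`IsRIPr.ae_eq`) carries the results to every
version. -/

lemma stdGaussian_eq_ofDensity :
    stdGaussian (Obs d) = ofDensity volume fun x : Obs d =>
      (Real.sqrt ((2 * Real.pi) ^ d))⁻¹ * Real.exp (-(1 / 2) * ‖x‖ ^ 2) := by
  have hc : Real.sqrt ((2 * Real.pi) ^ d) = (2 * Real.pi) ^ ((d : ℝ) / 2) := by
    rw [Real.sqrt_eq_rpow, ← Real.rpow_natCast, ← Real.rpow_mul (by positivity)]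
    ring_nf
  have hint : Integrable (fun x : Obs d =>
      (Real.sqrt ((2 * Real.pi) ^ d))⁻¹ * Real.exp (-(1 / 2) * ‖x‖ ^ 2)) := by
    refine Integrable.const_mul ?_ _
    have := GaussianFourier.integrable_cexp_neg_mul_sq_norm_add (V := Obs d) (b := 1 / 2)
      (by norm_num) 0 0
    refine this.norm.congr (ae_of_all _ fun x => ?_)
    simp [Complex.norm_exp, ← Complex.ofReal_pow]
  have : IsFiniteMeasure (ofDensity volume fun x : Obs d =>
      (Real.sqrt ((2 * Real.pi) ^ d))⁻¹ * Real.exp (-(1 / 2) * ‖x‖ ^ 2)) :=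
    isFiniteMeasure_withDensity_ofReal hint.2
  -- Finiteness suffices for comparing characteristic functions; the total mass comes out as the
  -- value at t = 0.
  refine Measure.ext_of_charFun ?_
  ext t
  rw [charFun_stdGaussian, charFun_apply, ofDensity,
    integral_withDensity_eq_integral_toReal_smul (by fun_prop)
      (ae_of_all _ fun x => ENNReal.ofReal_lt_top)]
  have h := GaussianFourier.integral_cexp_neg_mul_sq_norm_add (V := Obs d) (b := 1 / 2)
    (by norm_num) Complex.I t
  have h2 : ∀ x : Obs d, (ENNReal.ofReal ((Real.sqrt ((2 * Real.pi) ^ d))⁻¹ *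
      Real.exp (-(1 / 2) * ‖x‖ ^ 2))).toReal • Complex.exp (inner ℝ x t * Complex.I) =
      ((Real.sqrt ((2 * Real.pi) ^ d))⁻¹ : ℝ) *
        Complex.exp (-(1 / 2) * ‖x‖ ^ 2 + Complex.I * inner ℝ t x) := by
    intro x
    rw [ENNReal.toReal_ofReal (by positivity), Complex.real_smul, Complex.ofReal_mul,
      Complex.ofReal_exp, mul_assoc, ← Complex.exp_add, real_inner_comm, mul_comm Complex.I]
    push_cast; rfl
  simp_rw [h2]
  rw [integral_const_mul, h, hc, finrank_euclideanSpace_fin, Complex.ofReal_inv,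
    Complex.ofReal_cpow (by positivity)]
  have h3 : ((2 * Real.pi : ℝ) : ℂ) ^ (((d : ℝ) / 2 : ℝ) : ℂ) ≠ 0 := by
    rw [← Complex.ofReal_cpow (by positivity), Complex.ofReal_ne_zero]; positivity
  have h4 : ((Real.pi : ℂ) / (1 / 2)) ^ ((d : ℂ) / 2) =
      ((2 * Real.pi : ℝ) : ℂ) ^ (((d : ℝ) / 2 : ℝ) : ℂ) := by
    push_cast; ring_nf
  rw [h4, ← mul_assoc, inv_mul_cancel₀ h3, one_mul]
  congr 1
  rw [Complex.I_sq]; ring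

lemma measurable_gaussDensity_uncurry :
    Measurable fun z : Obs d × Obs d => gaussDensity S z.1 z.2 := by
  unfold gaussDensity
  refine Continuous.measurable ?_
  simp only [dotProduct, Matrix.mulVec]
  fun_prop

lemma continuous_gaussDensity_left (x : Obs d) : Continuous fun m => gaussDensity S m x := by
  unfold gaussDensity
  simp only [dotProduct, Matrix.mulVec]
  fun_prop

lemma measurable_gaussDensity (m : Obs d) : Measurable (gaussDensity S m) := by
  refine Continuous.measurable ?_
  unfold gaussDensity
  simp only [dotProduct, Matrix.mulVec]
  fun_prop

lemma gaussDensity_pos (hS : S.PosDef) (m x : Obs d) : 0 < gaussDensity S m x := by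
  have := hS.det_pos
  unfold gaussDensity; positivity

lemma gaussDensity_nonneg (m x : Obs d) : 0 ≤ gaussDensity S m x := by
  unfold gaussDensity; positivity

open scoped MatrixOrder in
-- Change of variables along x ↦ m + A x with A = S^{1/2}: the Jacobian |det A| = √(det S) absorbs
-- the determinant in the normalizing constant, and A S⁻¹ A = 1 turns the exponent into ‖x‖².
theorem multivariateGaussian_eq_ofDensity (hS : S.PosDef) (m : Obs d) :
    multivariateGaussian m S = ofDensity volume (gaussDensity S m) := by
  set A := CFC.sqrt S with hA
  have hAA : A * A = S := CFC.sqrt_mul_sqrt_self _ hS.posSemidef.nonneg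
  have hdet : A.det * A.det = S.det := by rw [← hAA, Matrix.det_mul]
  have hdet0 : A.det ≠ 0 := fun h => by
    have := hS.det_pos; rw [← hdet, h] at this; simp at this
  have hAsymm : Aᵀ = A := by
    have : (CFC.sqrt S).PosSemidef := 
      Matrix.nonneg_iff_posSemidef.1 (CFC.sqrt_nonneg S)
    simpa using this.isHermitian.eq
  set L : Obs d →L[ℝ] Obs d := Matrix.toEuclideanCLM (𝕜 := ℝ) A with hL
  have hLdet : L.det = A.det := by
    rw [ContinuousLinearMap.det, hL, Matrix.coe_toEuclideanCLM_eq_toEuclideanLin,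
      Matrix.toEuclideanLin_eq_toLin_orthonormal, LinearMap.det_toLin]
  have hinj : Function.Injective fun x => m + L x := by
    intro x y hxy
    have h1 : A *ᵥ x.ofLp = A *ᵥ y.ofLp := by
      have := congrArg WithLp.ofLp (add_left_cancel hxy)
      simpa [hL] using this
    have h2 := Matrix.mulVec_injective_iff_isUnit.2
      ((Matrix.isUnit_iff_isUnit_det A).2 (isUnit_iff_ne_zero.2 hdet0)) h1
    exact WithLp.ofLp_injective 2 h2
  have hsurj : Function.Surjective fun x => m + L x := by
    intro y
    refine ⟨WithLp.toLp 2 (A⁻¹ *ᵥ (y - m).ofLp), ?_⟩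
    simp only [hL, Matrix.toEuclideanCLM_toLp, Matrix.mulVec_mulVec]
    rw [Matrix.mul_nonsing_inv _ (isUnit_iff_ne_zero.2 hdet0)]
    simp
  have hden : ∀ x : Obs d, |A.det| * gaussDensity S m (m + L x) =
      (Real.sqrt ((2 * Real.pi) ^ d))⁻¹ * Real.exp (-(1 / 2) * ‖x‖ ^ 2) := by
    intro x
    have hq : (A *ᵥ x.ofLp) ⬝ᵥ (S⁻¹ *ᵥ (A *ᵥ x.ofLp)) = ‖x‖ ^ 2 := by
      rw [Matrix.mulVec_mulVec, ← hAA, Matrix.mul_inv_rev, Matrix.mul_assoc,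
        Matrix.nonsing_inv_mul _ (isUnit_iff_ne_zero.2 hdet0), Matrix.mul_one,
        Matrix.dotProduct_mulVec, ← Matrix.mulVec_transpose, Matrix.transpose_nonsing_inv, hAsymm,
        Matrix.mulVec_mulVec, Matrix.nonsing_inv_mul _ (isUnit_iff_ne_zero.2 hdet0),
        Matrix.one_mulVec, EuclideanSpace.real_norm_sq_eq]
      simp [dotProduct, sq]
    unfold gaussDensity
    rw [add_sub_cancel_left, hL, Matrix.ofLp_toEuclideanCLM, hq, ← mul_assoc,
      Real.sqrt_mul (by positivity), ← hdet, Real.sqrt_mul_self_eq_abs, mul_inv]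
    have := abs_pos.2 hdet0
    field_simp
  refine Measure.ext_of_lintegral _ fun f hf => ?_
  rw [multivariateGaussian, lintegral_map hf (by fun_prop), stdGaussian_eq_ofDensity,
    ofDensity, ofDensity, lintegral_withDensity_eq_lintegral_mul _ (by fun_prop) (by fun_prop),
    lintegral_withDensity_eq_lintegral_mul _ (measurable_gaussDensity m).ennreal_ofReal hf]
  have key := lintegral_image_eq_lintegral_abs_det_fderiv_mul volume MeasurableSet.univ
    (f := fun x => m + L x) (f' := fun _ => L)
    (fun x _ => (L.hasFDerivAt.const_add m).hasFDerivWithinAt) hinj.injOn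
    (fun x => ENNReal.ofReal (gaussDensity S m x) * f x)
  rw [Set.image_univ, hsurj.range_eq, Measure.restrict_univ] at key
  simp only [Pi.mul_apply]
  rw [key]
  refine lintegral_congr fun x => ?_
  rw [← mul_assoc, ← ENNReal.ofReal_mul (abs_nonneg _), hLdet, hden]

end GaussTest

/-! ### Affine images, mixtures and quadratic moments of Gaussians. -/

namespace GaussTest

variable {d n : ℕ} {S : Matrix (Fin d) (Fin d) ℝ}

/-- The law of an affine combination of the outcomes in an i.i.d. Gaussian sample. -/
theorem map_affine_iidLaw (hS : S.PosSemidef) (m v : Obs d) (c : Fin n → ℝ) :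
    (iidLaw S m n).map (fun u => v + ∑ j, c j • u j) =
      multivariateGaussian (v + (∑ j, c j) • m) ((∑ j, c j ^ 2) • S) := by
  have hmeas : Measurable fun u : Sample d n => v + ∑ j, c j • u j := by fun_prop
  have : IsProbabilityMeasure ((iidLaw S m n).map (fun u => v + ∑ j, c j • u j)) :=
    Measure.isProbabilityMeasure_map hmeas.aemeasurable
  refine Measure.ext_of_charFun ?_
  ext t
  rw [charFun_multivariateGaussian (hS.smul (Finset.sum_nonneg fun j _ => sq_nonneg _)),
    charFun_apply, integral_map hmeas.aemeasurable (by fun_prop)]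
  simp_rw [inner_add_left, sum_inner, Complex.ofReal_add, Complex.ofReal_sum, add_mul,
    Finset.sum_mul, Complex.exp_add, Complex.exp_sum]
  rw [integral_const_mul, iidLaw,
    integral_fintype_prod_eq_prod (f := fun j (x : Obs d) =>
      Complex.exp ((inner ℝ (c j • x) t : ℝ) * Complex.I))]
  have h : ∀ j, ∫ x : Obs d, Complex.exp ((inner ℝ (c j • x) t : ℝ) * Complex.I)
      ∂(multivariateGaussian m S) = Complex.exp (((c j * inner ℝ t m : ℝ) : ℂ) * Complex.I -
        ((c j ^ 2 * (t.ofLp ⬝ᵥ S *ᵥ t.ofLp) : ℝ) : ℂ) / 2) := by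
    intro j
    have := charFun_multivariateGaussian (μ := m) hS (c j • t)
    rw [charFun_apply] at this
    simp_rw [real_inner_smul_right] at this
    simp_rw [real_inner_smul_left]
    rw [this]
    congr 1
    rw [real_inner_smul_left, WithLp.ofLp_smul, Matrix.mulVec_smul, smul_dotProduct,
      dotProduct_smul]
    simp only [smul_eq_mul]
    push_cast; ring
  simp_rw [h]
  rw [← Complex.exp_sum, ← Complex.exp_add]
  congr 1
  rw [Finset.sum_sub_distrib, ← Finset.sum_mul, ← Finset.sum_div, inner_add_right,
    real_inner_smul_right, Matrix.smul_mulVec, dotProduct_smul, real_inner_comm t v]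
  push_cast
  simp only [← Finset.sum_mul, smul_eq_mul]
  push_cast; ring

lemma map_const_add_multivariateGaussian (m v : Obs d) :
    (multivariateGaussian m S).map (fun x => v + x) = multivariateGaussian (v + m) S := by
  rw [multivariateGaussian, Measure.map_map (by fun_prop) (by fun_prop), multivariateGaussian]
  congr 1
  ext1 x
  simp [add_assoc]

lemma map_smul_multivariateGaussian (hS : S.PosSemidef) (m : Obs d) (c : ℝ) :
    (multivariateGaussian m S).map (fun x => c • x) =
      multivariateGaussian (c • m) (c ^ 2 • S) := by
  refine Measure.ext_of_charFun ?_
  ext t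
  rw [charFun_map_smul, charFun_multivariateGaussian hS,
    charFun_multivariateGaussian (hS.smul (sq_nonneg _))]
  congr 1
  rw [WithLp.ofLp_smul, Matrix.mulVec_smul, smul_dotProduct, dotProduct_smul,
    real_inner_smul_left, real_inner_smul_right, Matrix.smul_mulVec, dotProduct_smul]
  simp only [smul_eq_mul]
  push_cast; ring

/-- Mixing N(m, S) over m ~ N(m₁, C) is convolving N(m₁, C) with N(0, S), where characteristic
functions multiply. -/
lemma lintegral_multivariateGaussian_add {C : Matrix (Fin d) (Fin d) ℝ} (hS : S.PosSemidef)
    (hC : C.PosSemidef) (m₁ : Obs d) {f : Obs d → ℝ≥0∞} (hf : Measurable f) :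
    ∫⁻ m, ∫⁻ x, f x ∂(multivariateGaussian m S) ∂(multivariateGaussian m₁ C) =
      ∫⁻ x, f x ∂(multivariateGaussian m₁ (S + C)) := by
  have h1 : ∀ m : Obs d, ∫⁻ x, f x ∂(multivariateGaussian m S) =
      ∫⁻ x, f (m + x) ∂(multivariateGaussian 0 S) := by
    intro m
    rw [← add_zero m, ← map_const_add_multivariateGaussian, lintegral_map hf (by fun_prop),
      add_zero]
  have h2 : multivariateGaussian m₁ C ∗ multivariateGaussian 0 S =
      multivariateGaussian m₁ (S + C) := by
    refine Measure.ext_of_charFun ?_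
    ext t
    rw [charFun_conv, charFun_multivariateGaussian hS, charFun_multivariateGaussian hC,
      charFun_multivariateGaussian (hS.add hC), ← Complex.exp_add]
    congr 1
    rw [Matrix.add_mulVec, dotProduct_add, inner_zero_right]
    push_cast; ring
  simp_rw [h1]
  rw [← h2, Measure.lintegral_conv hf]

/-- The quadratic form of the matrix `M`. -/
noncomputable def quadForm (M : Matrix (Fin d) (Fin d) ℝ) (x : Obs d) : ℝ := x.ofLp ⬝ᵥ (M *ᵥ x.ofLp)

lemma continuous_quadForm (M : Matrix (Fin d) (Fin d) ℝ) : Continuous (quadForm M) := by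
  unfold quadForm
  simp only [dotProduct, Matrix.mulVec]
  fun_prop

lemma quadForm_eq_sum (M : Matrix (Fin d) (Fin d) ℝ) (x : Obs d) :
    quadForm M x = ∑ i, ∑ j, M i j * (x i * x j) := by
  simp only [quadForm, dotProduct, Matrix.mulVec, Finset.mul_sum]
  exact Finset.sum_congr rfl fun i _ => Finset.sum_congr rfl fun j _ => by ring

lemma quadForm_nonneg {M : Matrix (Fin d) (Fin d) ℝ} (hM : M.PosSemidef) (x : Obs d) :
    0 ≤ quadForm M x := by
  simpa [quadForm] using hM.dotProduct_mulVec_nonneg x.ofLp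

@[simp] lemma quadForm_zero (M : Matrix (Fin d) (Fin d) ℝ) : quadForm M 0 = 0 := by
  simp [quadForm]

lemma quadForm_smul (M : Matrix (Fin d) (Fin d) ℝ) (c : ℝ) (x : Obs d) :
    quadForm M (c • x) = c ^ 2 * quadForm M x := by
  rw [quadForm, WithLp.ofLp_smul, Matrix.mulVec_smul, smul_dotProduct, dotProduct_smul, quadForm]
  simp only [smul_eq_mul]; ring

lemma quadForm_add {M : Matrix (Fin d) (Fin d) ℝ} (hM : M.IsHermitian) (x y : Obs d) :
    quadForm M (x + y) = quadForm M x + 2 * (x.ofLp ⬝ᵥ (M *ᵥ y.ofLp)) + quadForm M y := by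
  have : y.ofLp ⬝ᵥ (M *ᵥ x.ofLp) = x.ofLp ⬝ᵥ (M *ᵥ y.ofLp) := by
    have h : Mᵀ = M := by simpa using hM.eq
    rw [Matrix.dotProduct_mulVec, ← Matrix.mulVec_transpose, h, dotProduct_comm]
  simp only [quadForm, WithLp.ofLp_add, Matrix.mulVec_add, dotProduct_add, add_dotProduct, this]
  ring

lemma integrable_mul_apply_multivariateGaussian (m : Obs d) (i j : Fin d) :
    Integrable (fun x : Obs d => x i * x j) (multivariateGaussian m S) := by
  have h : ∀ i, MemLp (fun x : Obs d => x i) 2 (multivariateGaussian m S) := fun i =>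
    (EuclideanSpace.proj (𝕜 := ℝ) i : Obs d →L[ℝ] ℝ).comp_memLp' IsGaussian.memLp_two_id
  exact (h i).integrable_mul (h j)

lemma integral_mul_apply_multivariateGaussian (hS : S.PosSemidef) (m : Obs d) (i j : Fin d) :
    ∫ x : Obs d, x i * x j ∂(multivariateGaussian m S) = S i j + m i * m j := by
  have h : ∀ i, MemLp (fun x : Obs d => x i) 2 (multivariateGaussian m S) := fun i =>
    (EuclideanSpace.proj (𝕜 := ℝ) i : Obs d →L[ℝ] ℝ).comp_memLp' IsGaussian.memLp_two_id
  have h1 : ∀ i, ∫ x : Obs d, x i ∂(multivariateGaussian m S) = m i := fun i => by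
    have := (EuclideanSpace.proj (𝕜 := ℝ) i : Obs d →L[ℝ] ℝ).integral_comp_id_comm
      (IsGaussian.integrable_id (μ := multivariateGaussian m S))
    simpa using this
  have h2 := covariance_eval_multivariateGaussian (μ := m) hS i j
  rw [covariance_eq_sub (h i) (h j), h1, h1] at h2
  have h3 : ∫ x : Obs d, x i * x j ∂(multivariateGaussian m S) =
    ∫ x : Obs d, ((fun x : Obs d => x i) * fun x : Obs d => x j) x
      ∂(multivariateGaussian m S) := rfl
  linarith

lemma integrable_quadForm_sub (M : Matrix (Fin d) (Fin d) ℝ) (m w : Obs d) :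
    Integrable (fun x => quadForm M (x - w)) (multivariateGaussian m S) := by
  have h := map_const_add_multivariateGaussian (S := S) m (-w)
  have h2 : Integrable (quadForm M) (multivariateGaussian (-w + m) S) := by
    simp_rw [funext (quadForm_eq_sum M)]
    exact integrable_finsetSum _ fun i _ => integrable_finsetSum _ fun j _ =>
      (integrable_mul_apply_multivariateGaussian _ i j).const_mul _
  rw [← h, integrable_map_measure (continuous_quadForm M).aestronglyMeasurable (by fun_prop)] at h2
  refine h2.congr (ae_of_all _ fun x => ?_)
  simp [neg_add_eq_sub]

lemma integral_quadForm_sub (hS : S.PosSemidef) (M : Matrix (Fin d) (Fin d) ℝ) (m w : Obs d) :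
    ∫ x, quadForm M (x - w) ∂(multivariateGaussian m S) = (S * M).trace + quadForm M (m - w) := by
  have h := map_const_add_multivariateGaussian (S := S) m (-w)
  have h2 : ∫ x, quadForm M x ∂(multivariateGaussian (-w + m) S) =
      (S * M).trace + quadForm M (m - w) := by
    have h3 : ∀ i j, Integrable (fun x : Obs d => M i j * (x i * x j))
        (multivariateGaussian (-w + m) S) := fun i j =>
      (integrable_mul_apply_multivariateGaussian _ i j).const_mul _
    calc ∫ x, quadForm M x ∂(multivariateGaussian (-w + m) S)
        = ∫ x : Obs d, ∑ i, ∑ j, M i j * (x i * x j) ∂(multivariateGaussian (-w + m) S) :=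
          integral_congr_ae (ae_of_all _ fun x => quadForm_eq_sum M x)
      _ = ∑ i, ∑ j, M i j * (S i j + (-w + m) i * (-w + m) j) := by
          rw [integral_finsetSum _ fun i _ => integrable_finsetSum _ fun j _ => h3 i j]
          refine Finset.sum_congr rfl fun i _ => ?_
          rw [integral_finsetSum _ fun j _ => h3 i j]
          refine Finset.sum_congr rfl fun j _ => ?_
          rw [integral_const_mul, integral_mul_apply_multivariateGaussian hS]
      _ = _ := ?_
    rw [quadForm_eq_sum]
    simp_rw [mul_add, Finset.sum_add_distrib]
    congr 1
    -- Symmetry of S turns ∑ M i j * S i j into the trace of S * M.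
    · have hsymm : ∀ i j, S i j = S j i := fun i j => by
        have := congrFun (congrFun hS.isHermitian.eq j) i
        simpa using this
      simp only [Matrix.trace, Matrix.diag, Matrix.mul_apply]
      rw [Finset.sum_comm]
      refine Finset.sum_congr rfl fun i _ => Finset.sum_congr rfl fun j _ => ?_
      rw [hsymm, mul_comm]
    · simp [neg_add_eq_sub]
  rw [← h2, ← h, integral_map (by fun_prop) (continuous_quadForm M).aestronglyMeasurable]
  simp [neg_add_eq_sub]

lemma gaussDensity_eq (S : Matrix (Fin d) (Fin d) ℝ) (m x : Obs d) :
    gaussDensity S m x = (Real.sqrt ((2 * Real.pi) ^ d * S.det))⁻¹ *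
      Real.exp (-(1 / 2) * quadForm S⁻¹ (x - m)) := rfl

/-- The logarithm of the Gaussian normalizing constant. -/
noncomputable def logNorm (S : Matrix (Fin d) (Fin d) ℝ) : ℝ :=
  -(1 / 2) * Real.log ((2 * Real.pi) ^ d * S.det)

lemma gaussNorm_eq_exp (hS : S.PosDef) :
    (Real.sqrt ((2 * Real.pi) ^ d * S.det))⁻¹ = Real.exp (logNorm S) := by
  have : 0 < (2 * Real.pi) ^ d * S.det := by have := hS.det_pos; positivity
  rw [logNorm, Real.sqrt_eq_rpow, ← Real.rpow_neg this.le, Real.rpow_def_of_pos this]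
  ring_nf

lemma gaussDensity_eq_exp (hS : S.PosDef) (m x : Obs d) :
    gaussDensity S m x = Real.exp (logNorm S - 1 / 2 * quadForm S⁻¹ (x - m)) := by
  rw [gaussDensity_eq, gaussNorm_eq_exp hS, ← Real.exp_add]; ring_nf

lemma log_gaussDensity (hS : S.PosDef) (m x : Obs d) :
    Real.log (gaussDensity S m x) = logNorm S - 1 / 2 * quadForm S⁻¹ (x - m) := by
  rw [gaussDensity_eq_exp hS, Real.log_exp]

end GaussTest

/-! ### Sufficiency of Z, the maximized likelihood and Bayes marginals. -/

namespace GaussTest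

section Density

variable {α : Type*} [MeasurableSpace α] {ν : Measure α} {f g : α → ℝ}

lemma lintegral_ofDensity (hf : Measurable f) {h : α → ℝ≥0∞} (hh : Measurable h) :
    ∫⁻ x, h x ∂(ofDensity ν f) = ∫⁻ x, ENNReal.ofReal (f x) * h x ∂ν := by
  rw [ofDensity, lintegral_withDensity_eq_lintegral_mul _ hf.ennreal_ofReal hh]
  rfl

lemma ofDensity_eq_withDensity_div (hf : Measurable f) (hg : Measurable g)
    (hgpos : ∀ x, 0 < g x) :
    ofDensity ν f = (ofDensity ν g).withDensity fun x => ENNReal.ofReal (f x / g x) := by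
  rw [ofDensity, ofDensity,
    ← withDensity_mul _ hg.ennreal_ofReal (f := fun x => ENNReal.ofReal (g x))
      (g := fun x => ENNReal.ofReal (f x / g x)) (hf.div hg).ennreal_ofReal]
  congr 1
  ext1 x
  rw [Pi.mul_apply, ← ENNReal.ofReal_mul (hgpos x).le, mul_div_cancel₀ _ (hgpos x).ne']

lemma absolutelyContinuous_ofDensity (hf : Measurable f) (hpos : ∀ x, 0 < f x) :
    ν ≪ ofDensity ν f := by
  refine withDensity_absolutelyContinuous' hf.ennreal_ofReal.aemeasurable (ae_of_all _ fun x => ?_)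
  simpa using hpos x

lemma ofDensity_absolutelyContinuous : ofDensity ν f ≪ ν :=
  withDensity_absolutelyContinuous _ _

end Density

variable {d n : ℕ} {S : Matrix (Fin d) (Fin d) ℝ}

lemma integrable_gaussDensity (hS : S.PosDef) (m : Obs d) :
    Integrable (gaussDensity S m) := by
  refine ⟨(measurable_gaussDensity m).aestronglyMeasurable, ?_⟩
  rw [hasFiniteIntegral_iff_ofReal (ae_of_all _ fun x => gaussDensity_nonneg m x)]
  have h := measure_univ (μ := multivariateGaussian m S)
  rw [multivariateGaussian_eq_ofDensity hS, ofDensity, withDensity_apply _ MeasurableSet.univ,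
    Measure.restrict_univ] at h
  rw [h]; exact ENNReal.one_lt_top

lemma measurable_iidDensity (m : Obs d) :
    Measurable fun u : Sample d n => iidDensity S m u := by
  unfold iidDensity
  exact Finset.measurable_fun_prod _ fun i _ => (measurable_gaussDensity m).comp (measurable_pi_apply i)

lemma iidDensity_pos (hS : S.PosDef) (m : Obs d) (u : Sample d n) : 0 < iidDensity S m u :=
  Finset.prod_pos fun _ _ => gaussDensity_pos hS _ _

lemma iidLaw_eq_ofDensity (hS : S.PosDef) (m : Obs d) (n : ℕ) :
    iidLaw S m n = ofDensity volume fun u : Sample d n => iidDensity S m u := by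
  refine Measure.pi_eq fun s hs => ?_
  have hi : Integrable (fun u : Sample d n => iidDensity S m u)
      (Measure.pi fun i => volume.restrict (s i)) :=
    Integrable.fintype_prod fun i => (integrable_gaussDensity hS m).integrableOn
  rw [ofDensity, withDensity_apply _ (MeasurableSet.univ_pi hs), volume_pi,
    Measure.restrict_pi_pi, ← ofReal_integral_eq_lintegral_ofReal hi
    (ae_of_all _ fun u => (iidDensity_pos hS m u).le)]
  unfold iidDensity
  rw [integral_fintype_prod_eq_prod (f := fun _ => gaussDensity S m),
    ENNReal.ofReal_prod_of_nonneg fun i _ => integral_nonneg fun x => gaussDensity_nonneg m x]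
  refine Finset.prod_congr rfl fun i _ => ?_
  rw [ofReal_integral_eq_lintegral_ofReal (integrable_gaussDensity hS m).integrableOn
    (ae_of_all _ fun u => gaussDensity_nonneg m u), multivariateGaussian_eq_ofDensity hS,
    ofDensity, withDensity_apply _ (hs i)]

lemma volume_absolutelyContinuous_iidLaw (hS : S.PosDef) (m : Obs d) (n : ℕ) :
    (volume : Measure (Sample d n)) ≪ iidLaw S m n := by
  rw [iidLaw_eq_ofDensity hS]
  exact absolutelyContinuous_ofDensity (measurable_iidDensity m) (iidDensity_pos hS m)

lemma iidLaw_absolutelyContinuous_volume (hS : S.PosDef) (m : Obs d) (n : ℕ) :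
    iidLaw S m n ≪ volume := by
  rw [iidLaw_eq_ofDensity hS]
  exact ofDensity_absolutelyContinuous

@[fun_prop]
lemma measurable_suffStat : Measurable (suffStat : Sample d n → Obs d) := by
  unfold suffStat
  fun_prop

/-- The weights n^{-1/2} have sum √n and squares summing to 1, so the covariance stays S for every
n. -/
lemma map_suffStat_iidLaw (hS : S.PosDef) (m : Obs d) (hn : 1 ≤ n) :
    (iidLaw S m n).map suffStat = multivariateGaussian (Real.sqrt n • m) S := by
  have h := map_affine_iidLaw (n := n) hS.posSemidef m 0 fun _ => (Real.sqrt n)⁻¹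
  have hpos : (0 : ℝ) < n := by exact_mod_cast hn
  have h1 : (n : ℝ) * (Real.sqrt n)⁻¹ = Real.sqrt n := by
    rw [← div_eq_mul_inv, Real.div_sqrt]
  have h2 : (n : ℝ) * (Real.sqrt n)⁻¹ ^ 2 = 1 := by
    rw [inv_pow, Real.sq_sqrt hpos.le, mul_inv_cancel₀ hpos.ne']
  simp only [zero_add, ← Finset.smul_sum, Finset.sum_const, Finset.card_univ, Fintype.card_fin,
    nsmul_eq_mul, h1, h2, one_smul] at h
  exact h

/-- The factor of the likelihood of an i.i.d. Gaussian sample that does not depend on the mean: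
the conditional density of the sample given the sufficient statistic. -/
noncomputable def condFactor (S : Matrix (Fin d) (Fin d) ℝ) (u : Sample d n) : ℝ :=
  iidDensity S 0 u / gaussDensity S 0 (suffStat u)

lemma measurable_condFactor : Measurable fun u : Sample d n => condFactor S u :=
  (measurable_iidDensity 0).div ((measurable_gaussDensity 0).comp measurable_suffStat)

lemma condFactor_pos (hS : S.PosDef) (u : Sample d n) : 0 < condFactor S u :=
  div_pos (iidDensity_pos hS _ _) (gaussDensity_pos hS _ _)

lemma quadForm_sub {M : Matrix (Fin d) (Fin d) ℝ} (hM : M.IsHermitian) (x y : Obs d) :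
    quadForm M (x - y) = quadForm M x - 2 * (x.ofLp ⬝ᵥ (M *ᵥ y.ofLp)) + quadForm M y := by
  rw [sub_eq_add_neg, quadForm_add hM, ← neg_one_smul ℝ y, quadForm_smul]
  simp [Matrix.mulVec_neg]
  ring

lemma iidDensity_eq_exp (hS : S.PosDef) (m : Obs d) (u : Sample d n) :
    iidDensity S m u = Real.exp (n * logNorm S - 1 / 2 * ∑ i, quadForm S⁻¹ (u i - m)) := by
  simp only [iidDensity, gaussDensity_eq_exp hS]
  rw [← Real.exp_sum, Finset.sum_sub_distrib, Finset.mul_sum]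
  simp

/-- Sufficiency of `suffStat`: factorization of the likelihood. -/
theorem iidDensity_eq_condFactor_mul (hS : S.PosDef) (hn : 1 ≤ n) (m : Obs d) (u : Sample d n) :
    iidDensity S m u = condFactor S u * gaussDensity S (Real.sqrt n • m) (suffStat u) := by
  have hpos : (0 : ℝ) < n := by exact_mod_cast hn
  have hsum : ∑ i, u i = Real.sqrt n • suffStat u := by
    rw [suffStat, smul_smul, mul_inv_cancel₀ (Real.sqrt_pos.2 hpos).ne', one_smul]
  have hM := hS.inv.isHermitian
  -- The cross term is the only one coupling sample and mean, and it sees the sample only through Z.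
  have hcross : ∑ i, (u i).ofLp ⬝ᵥ (S⁻¹ *ᵥ m.ofLp) =
      Real.sqrt n * ((suffStat u).ofLp ⬝ᵥ (S⁻¹ *ᵥ m.ofLp)) := by
    rw [← sum_dotProduct, ← WithLp.ofLp_sum, hsum, WithLp.ofLp_smul, smul_dotProduct, smul_eq_mul]
  rw [condFactor, iidDensity_eq_exp hS, iidDensity_eq_exp hS, gaussDensity_eq_exp hS,
    gaussDensity_eq_exp hS, ← Real.exp_sub, ← Real.exp_add]
  congr 1
  simp only [sub_zero, quadForm_sub hM, Finset.sum_add_distrib, Finset.sum_sub_distrib,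
    ← Finset.mul_sum, hcross, quadForm_smul, Real.sq_sqrt hpos.le, WithLp.ofLp_smul,
    Matrix.mulVec_smul, dotProduct_smul, smul_eq_mul]
  simp
  ring

/-- The mean enters only through the density of N(√n m, S) at Z, which is largest when √n m = Z. -/
lemma maxLikelihood_eq (hS : S.PosDef) (hn : 1 ≤ n) (u : Sample d n) :
    maxLikelihood S u = condFactor S u * Real.exp (logNorm S) := by
  have hpos : (0 : ℝ) < n := by exact_mod_cast hn
  have hle : ∀ m, iidDensity S m u ≤ condFactor S u * Real.exp (logNorm S) := by
    intro m
    rw [iidDensity_eq_condFactor_mul hS hn, gaussDensity_eq_exp hS]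
    refine mul_le_mul_of_nonneg_left (Real.exp_le_exp.2 ?_) (condFactor_pos hS u).le
    have := quadForm_nonneg hS.inv.posSemidef (suffStat u - Real.sqrt n • m)
    linarith
  refine le_antisymm (ciSup_le hle) ?_
  refine le_ciSup_of_le ⟨_, Set.forall_mem_range.2 hle⟩ ((Real.sqrt n)⁻¹ • suffStat u) ?_
  rw [iidDensity_eq_condFactor_mul hS hn, gaussDensity_eq_exp hS, smul_smul,
    mul_inv_cancel₀ (Real.sqrt_pos.2 hpos).ne']
  simp

/-- Both sides are densities of the same Gaussian mixture, by Tonelli; comparing integrals over sets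
yields equality almost everywhere, which is all that is needed. -/
lemma integral_gaussDensity_multivariateGaussian {C : Matrix (Fin d) (Fin d) ℝ} (hS : S.PosDef)
    (hC : C.PosSemidef) (m₁ : Obs d) :
    (fun x => ∫ m, gaussDensity S m x ∂(multivariateGaussian m₁ C)) =ᵐ[volume]
      gaussDensity (S + C) m₁ := by
  have hSC : (S + C).PosDef := hS.add_posSemidef hC
  have hmeas : Measurable fun x => ∫⁻ m, ENNReal.ofReal (gaussDensity S m x)
      ∂(multivariateGaussian m₁ C) :=
    Measurable.lintegral_prod_left (measurable_gaussDensity_uncurry (S := S)).ennreal_ofReal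
  have h : (fun x => ∫⁻ m, ENNReal.ofReal (gaussDensity S m x) ∂(multivariateGaussian m₁ C))
      =ᵐ[volume] fun x => ENNReal.ofReal (gaussDensity (S + C) m₁ x) := by
    refine ae_eq_of_forall_setLIntegral_eq_of_sigmaFinite hmeas
      (measurable_gaussDensity m₁).ennreal_ofReal fun s hs _ => ?_
    have h1 := lintegral_multivariateGaussian_add hS.posSemidef hC m₁
      (measurable_one.indicator hs (f := (1 : Obs d → ℝ≥0∞)))
    simp_rw [lintegral_indicator_one hs] at h1
    rw [multivariateGaussian_eq_ofDensity hSC, ofDensity, withDensity_apply _ hs] at h1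
    rw [← h1, lintegral_lintegral_swap]
    · refine lintegral_congr fun m => ?_
      rw [multivariateGaussian_eq_ofDensity hS, ofDensity, withDensity_apply _ hs]
    · exact ((measurable_gaussDensity_uncurry (S := S)).comp
        measurable_swap).ennreal_ofReal.aemeasurable
  filter_upwards [h] with x hx
  rw [integral_eq_lintegral_of_nonneg_ae (ae_of_all _ fun m => gaussDensity_nonneg m x)
    (continuous_gaussDensity_left x).aestronglyMeasurable, hx,
    ENNReal.toReal_ofReal (gaussDensity_nonneg _ _)]

/-- Pull the mean-free factor out of the integral; what remains is a mixture of N(√n m, S), and √n m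
~ N(√n m₁, nC) under the prior. -/
lemma bayesDensity_ae_eq {C : Matrix (Fin d) (Fin d) ℝ} (hS : S.PosDef)
    (hC : C.PosSemidef) (hn : 1 ≤ n) (m₁ : Obs d) :
    (fun u : Sample d n => bayesDensity S m₁ C u) =ᵐ[volume]
      fun u => condFactor S u *
        gaussDensity (S + (n : ℝ) • C) (Real.sqrt n • m₁) (suffStat u) := by
  have h := integral_gaussDensity_multivariateGaussian hS
    (hC.smul (Nat.cast_nonneg n : (0 : ℝ) ≤ n)) (Real.sqrt n • m₁)
  have h1 := map_smul_multivariateGaussian hC m₁ (Real.sqrt n)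
  rw [Real.sq_sqrt (Nat.cast_nonneg n)] at h1
  rw [← h1] at h
  -- An almost-everywhere identity in z becomes one in u: Lebesgue measure on samples is dominated
  -- by a Gaussian i.i.d. law, under which Z has a density.
  have hq : Tendsto suffStat (ae (volume : Measure (Sample d n))) (ae volume) := by
    have hac : (volume : Measure (Sample d n)).map suffStat ≪ volume := by
      refine ((volume_absolutelyContinuous_iidLaw hS 0 n).map measurable_suffStat).trans ?_
      rw [map_suffStat_iidLaw hS 0 hn, multivariateGaussian_eq_ofDensity hS]
      exact ofDensity_absolutelyContinuous
    exact (Measure.QuasiMeasurePreserving.mk measurable_suffStat hac).tendsto_ae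
  filter_upwards [hq.eventually h] with u hu
  rw [← hu, bayesDensity, integral_map (by fun_prop)
    (continuous_gaussDensity_left _).aestronglyMeasurable, ← integral_const_mul]
  simp_rw [iidDensity_eq_condFactor_mul hS hn]

end GaussTest

/-! ### Conditional densities given the sufficient statistic. -/

namespace GaussTest

section Conditional

variable {Ω β : Type*} [MeasurableSpace Ω] [StandardBorelSpace Ω] [Nonempty Ω]
  [MeasurableSpace β]

/-- If the likelihood ratio of `Q` against `P` factors as `r * g ∘ X`, where `g` is the likelihood
ratio of `X`, then `r` is the ratio of the conditional densities given `X`. -/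
theorem condDistrib_rnDeriv_div_ae_eq [MeasurableSpace.CountableOrCountablyGenerated β Ω]
    {P Q : Measure Ω} [IsProbabilityMeasure P] [IsProbabilityMeasure Q]
    {X : Ω → β} (hX : Measurable X) {r : Ω → ℝ≥0∞} (hr : Measurable r) (hr_top : ∀ u, r u ≠ ∞)
    {g : β → ℝ≥0∞} (hg : Measurable g)
    (hQX : Q.map X = (P.map X).withDensity g)
    (hQ : Q = P.withDensity fun u => r u * g (X u)) :
    ∀ᵐ u ∂Q,
      Kernel.rnDeriv (condDistrib (fun u => u) X Q)
          (condDistrib (fun u => u) X P + condDistrib (fun u => u) X Q) (X u) u /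
        Kernel.rnDeriv (condDistrib (fun u => u) X P)
          (condDistrib (fun u => u) X P + condDistrib (fun u => u) X Q) (X u) u = r u := by
  set κp : Kernel β Ω := condDistrib (fun u => u) X P with hκp
  set κq : Kernel β Ω := condDistrib (fun u => u) X Q with hκq
  set η := κp + κq with hη
  have hP_joint : P.map X ⊗ₘ κp = P.map fun u => (X u, u) :=
    compProd_map_condDistrib measurable_id.aemeasurable
  have hQ_joint : Q.map X ⊗ₘ κq = Q.map fun u => (X u, u) :=
    compProd_map_condDistrib measurable_id.aemeasurable
  have hpair : Measurable fun u => (X u, u) := hX.prodMk measurable_id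
  -- If r is the ratio of the conditional densities, their densities relative to the sum must be
  -- 1/(1 + r) and r/(1 + r).
  let f' : Ω → ℝ≥0∞ := fun u => (1 + r u)⁻¹
  let f : Ω → ℝ≥0∞ := fun u => r u * f' u
  have hf' : Measurable f' := (hr.const_add 1).inv
  have hf : Measurable f := hr.mul hf'
  have h1r : ∀ u, 1 + r u ≠ 0 := fun u => by simp
  have h1r' : ∀ u, 1 + r u ≠ ∞ := fun u => by simp [hr_top u]
  have hff : ∀ u, f' u + f u = 1 := fun u => by
    have : f' u + f u = (1 + r u) * f' u := by simp only [f]; ring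
    rw [this, ENNReal.mul_inv_cancel (h1r u) (h1r' u)]
  have hf1 : ∀ u, f u ≤ 1 := fun u => by rw [← hff u]; exact le_add_self
  have hf_unc : Measurable (Function.uncurry fun (_ : β) u => f u) := hf.comp measurable_snd
  have hfin : IsFiniteKernel (η.withDensity fun _ u => f u) :=
    Kernel.isFiniteKernel_withDensity_of_bounded η ENNReal.one_ne_top fun _ u => hf1 u
  -- Conditional distributions are determined by the joint law with X. Written as P-integrals, the
  -- two parts of the sum kernel have weights g f and r g f, and these add to r g, the likelihood
  -- ratio.
  have key : κq =ᵐ[Q.map X] η.withDensity fun _ u => f u := by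
    refine condDistrib_ae_eq_of_measure_eq_compProd_of_measurable hX measurable_id ?_
    rw [Measure.compProd_withDensity hf_unc]
    refine Measure.ext_of_lintegral _ fun h hh => ?_
    have hm : Measurable fun z : β × Ω => f z.2 * h z := (hf.comp measurable_snd).mul hh
    change ∫⁻ z, h z ∂(Q.map fun u => (X u, u)) = _
    rw [lintegral_withDensity_eq_lintegral_mul _ (f := fun p : β × Ω => f p.2)
      (hf.comp measurable_snd) hh, Measure.compProd_add_right, lintegral_add_measure, hQ_joint,
      lintegral_map hh hpair]
    simp only [Pi.mul_apply]
    rw [lintegral_map hm hpair]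
    have e1 : ∫⁻ z, f z.2 * h z ∂(Q.map X ⊗ₘ κp) =
        ∫⁻ u, g (X u) * (f u * h (X u, u)) ∂P := by
      have hm2 : Measurable fun z : β × Ω => g z.1 * (f z.2 * h z) :=
        (hg.comp measurable_fst).mul hm
      rw [Measure.lintegral_compProd hm, hQX,
        lintegral_withDensity_eq_lintegral_mul _ hg
          (Measurable.lintegral_kernel_prod_right' hm)]
      simp only [Pi.mul_apply]
      rw [← lintegral_map (f := fun z : β × Ω => g z.1 * (f z.2 * h z)) hm2 hpair, ← hP_joint,
        Measure.lintegral_compProd hm2]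
      refine lintegral_congr fun z => ?_
      exact (lintegral_const_mul _ (hm.comp measurable_prodMk_left)).symm
    have hrg : Measurable fun u => r u * g (X u) := hr.mul (hg.comp hX)
    have e2 : ∀ F : Ω → ℝ≥0∞, Measurable F →
        ∫⁻ u, F u ∂Q = ∫⁻ u, (r u * g (X u)) * F u ∂P := fun F hF => by
      rw [hQ, lintegral_withDensity_eq_lintegral_mul _ hrg hF]; rfl
    have hm3 : Measurable fun u => f u * h (X u, u) := hf.mul (hh.comp hpair)
    rw [e1, e2 _ hm3, ← lintegral_add_left (by fun_prop)]
    have e3 := e2 _ (hh.comp hpair)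
    simp only [Function.comp_def] at e3
    rw [e3]
    refine lintegral_congr fun u => ?_
    have : g (X u) * (f u * h (X u, u)) + r u * g (X u) * (f u * h (X u, u)) =
        r u * g (X u) * h (X u, u) * ((1 + r u) * f' u) := by simp only [f]; ring
    rw [this, ENNReal.mul_inv_cancel (h1r u) (h1r' u), mul_one]
  have hae : ∀ᵐ z ∂(Q.map X), ∀ᵐ u ∂(κq z), κq.rnDeriv η z u / κp.rnDeriv η z u = r u := by
    filter_upwards [key] with z hz
    rw [Kernel.withDensity_apply _ hf_unc] at hz
    have hηz : η z = κp z + κq z := rfl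
    -- The two densities add to 1, so cancelling the finite measure `κq z` identifies the
    -- complementary part.
    have hp : κp z = (η z).withDensity f' := by
      have h1 : (η z).withDensity f' + (η z).withDensity f = η z := by
        rw [← withDensity_add_left hf']
        have : f' + f = 1 := funext hff
        rw [this, withDensity_one]
      have h2 : (η z).withDensity f' + κq z = κp z + κq z := by
        rw [← hηz]; conv_rhs => rw [← h1]
        rw [← hz]
      exact ((Measure.add_left_inj _ _ _).1 h2).symm
    have hac : κq z ≪ η z := by rw [hηz, add_comm]; exact Measure.AbsolutelyContinuous.rfl.add_right _
    have r1 : κq.rnDeriv η z =ᵐ[η z] f := by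
      refine (Kernel.rnDeriv_eq_rnDeriv_measure).trans ?_
      rw [hz]; exact Measure.rnDeriv_withDensity _ hf
    have r2 : κp.rnDeriv η z =ᵐ[η z] f' := by
      refine (Kernel.rnDeriv_eq_rnDeriv_measure).trans ?_
      rw [hp]; exact Measure.rnDeriv_withDensity _ hf'
    filter_upwards [hac.ae_le r1, hac.ae_le r2] with u h1 h2
    rw [h1, h2]
    exact ENNReal.mul_div_cancel_right (ENNReal.inv_ne_zero.2 (h1r' u))
      (ENNReal.inv_ne_top.2 (h1r u))
  have hmeas : MeasurableSet {z : β × Ω | κq.rnDeriv η z.1 z.2 / κp.rnDeriv η z.1 z.2 = r z.2} :=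
    measurableSet_eq_fun ((Kernel.measurable_rnDeriv _ _).div (Kernel.measurable_rnDeriv _ _))
      (hr.comp measurable_snd)
  have := (Measure.ae_compProd_iff hmeas).2 hae
  rw [hQ_joint] at this
  exact ae_of_ae_map hpair.aemeasurable this

end Conditional

variable {d n : ℕ} {Sp Sq : Matrix (Fin d) (Fin d) ℝ}

/-- The means a and b affect only the likelihood ratio of Z, so they drop out of r. The almost-sure
statement under the alternative extends to Lebesgue measure because its density is positive. -/
theorem condStat_ae_eq (hSp : Sp.PosDef) (hSq : Sq.PosDef) (hn : 1 ≤ n) (a b : Obs d) :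
    (fun u : Sample d n => condStat Sp Sq a b u) =ᵐ[volume]
      fun u => condFactor Sq u / condFactor Sp u := by
  have h := condDistrib_rnDeriv_div_ae_eq (P := iidLaw Sp a n) (Q := iidLaw Sq b n)
    (X := suffStat) measurable_suffStat
    (r := fun u => ENNReal.ofReal (condFactor Sq u / condFactor Sp u))
    (measurable_condFactor.div measurable_condFactor).ennreal_ofReal (fun _ => ENNReal.ofReal_ne_top)
    (g := fun z => ENNReal.ofReal (gaussDensity Sq (Real.sqrt n • b) z /
      gaussDensity Sp (Real.sqrt n • a) z))
    ((measurable_gaussDensity _).div (measurable_gaussDensity _)).ennreal_ofReal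
    (by
      rw [map_suffStat_iidLaw hSq b hn, map_suffStat_iidLaw hSp a hn,
        multivariateGaussian_eq_ofDensity hSq, multivariateGaussian_eq_ofDensity hSp]
      exact ofDensity_eq_withDensity_div (measurable_gaussDensity _) (measurable_gaussDensity _)
        (gaussDensity_pos hSp _))
    (by
      rw [iidLaw_eq_ofDensity hSq, iidLaw_eq_ofDensity hSp, ofDensity_eq_withDensity_div
        (measurable_iidDensity _) (measurable_iidDensity _) (iidDensity_pos hSp _)]
      congr 1
      ext1 u
      rw [← ENNReal.ofReal_mul (div_pos (condFactor_pos hSq u) (condFactor_pos hSp u)).le,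
        iidDensity_eq_condFactor_mul hSq hn, iidDensity_eq_condFactor_mul hSp hn,
        mul_div_mul_comm])
  filter_upwards [(volume_absolutelyContinuous_iidLaw hSq b n).ae_le h] with u hu
  unfold condStat condLaw
  rw [hu, ENNReal.toReal_ofReal (div_pos (condFactor_pos hSq u) (condFactor_pos hSp u)).le]

end GaussTest

/-! ### Expected log-likelihoods and their growth. -/

namespace GaussTest

variable {d n : ℕ} {S T : Matrix (Fin d) (Fin d) ℝ}

lemma integrable_log_gaussDensity (hS : S.PosDef) (m w : Obs d) :
    Integrable (fun x => Real.log (gaussDensity S w x)) (multivariateGaussian m T) := by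
  simp_rw [log_gaussDensity hS]
  exact (integrable_const _).sub ((integrable_quadForm_sub _ m w).const_mul _)

lemma integral_log_gaussDensity (hS : S.PosDef) (hT : T.PosSemidef) (m w : Obs d) :
    ∫ x, Real.log (gaussDensity S w x) ∂(multivariateGaussian m T) =
      logNorm S - 1 / 2 * (effDim T S + quadForm S⁻¹ (m - w)) := by
  simp_rw [log_gaussDensity hS]
  rw [integral_sub (integrable_const _) ((integrable_quadForm_sub _ m w).const_mul _),
    integral_const_mul, integral_quadForm_sub hT]
  simp [effDim]

lemma measurable_log_gaussDensity (w : Obs d) :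
    Measurable fun x => Real.log (gaussDensity S w x) :=
  Real.measurable_log.comp (measurable_gaussDensity w)

/-- The expected log-likelihood of one outcome at the true mean. -/
noncomputable def meanLogLik (T S : Matrix (Fin d) (Fin d) ℝ) : ℝ := logNorm S - 1 / 2 * effDim T S

lemma log_iidDensity (hS : S.PosDef) (m : Obs d) (u : Sample d n) :
    Real.log (iidDensity S m u) = ∑ i, Real.log (gaussDensity S m (u i)) :=
  Real.log_prod fun _ _ => (gaussDensity_pos hS _ _).ne'

lemma integrable_log_gaussDensity_eval (hS : S.PosDef) (m w : Obs d) (i : Fin n) :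
    Integrable (fun u : Sample d n => Real.log (gaussDensity S w (u i))) (iidLaw T m n) :=
  integrable_comp_eval (μ := fun _ : Fin n => multivariateGaussian m T)
    (f := fun x => Real.log (gaussDensity S w x)) (integrable_log_gaussDensity hS m w)

lemma integrable_log_iidDensity (hS : S.PosDef) (m w : Obs d) :
    Integrable (fun u => Real.log (iidDensity S w u)) (iidLaw T m n) := by
  simp_rw [log_iidDensity hS]
  exact integrable_finsetSum _ fun i _ => integrable_log_gaussDensity_eval hS m w i

lemma integral_log_iidDensity (hS : S.PosDef) (hT : T.PosSemidef) (m : Obs d) :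
    ∫ u, Real.log (iidDensity S m u) ∂(iidLaw T m n) = n * meanLogLik T S := by
  simp_rw [log_iidDensity hS]
  rw [integral_finsetSum _ fun i _ => integrable_log_gaussDensity_eval hS m m i]
  have : ∀ i : Fin n, ∫ u : Sample d n, Real.log (gaussDensity S m (u i)) ∂(iidLaw T m n) =
      meanLogLik T S := fun i => by
    rw [iidLaw, integral_comp_eval (μ := fun _ : Fin n => multivariateGaussian m T)
      (f := fun x => Real.log (gaussDensity S m x))
      (measurable_log_gaussDensity m).aestronglyMeasurable, integral_log_gaussDensity hS hT]
    simp [meanLogLik]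
  simp [this]

lemma integrable_log_gaussDensity_suffStat (hS : S.PosDef) (hT : T.PosDef) (hn : 1 ≤ n)
    (m w : Obs d) :
    Integrable (fun u => Real.log (gaussDensity S w (suffStat u))) (iidLaw T m n) := by
  have h := integrable_log_gaussDensity (T := T) hS (Real.sqrt n • m) w
  rw [← map_suffStat_iidLaw hT m hn] at h
  exact (integrable_map_measure (measurable_log_gaussDensity w).aestronglyMeasurable
    measurable_suffStat.aemeasurable).1 h

lemma integral_log_gaussDensity_suffStat (hS : S.PosDef) (hT : T.PosDef) (hn : 1 ≤ n)
    (m w : Obs d) :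
    ∫ u, Real.log (gaussDensity S w (suffStat u)) ∂(iidLaw T m n) =
      logNorm S - 1 / 2 * (effDim T S + quadForm S⁻¹ (Real.sqrt n • m - w)) := by
  rw [← integral_log_gaussDensity hS hT.posSemidef, ← map_suffStat_iidLaw hT m hn,
    integral_map measurable_suffStat.aemeasurable
      (measurable_log_gaussDensity w).aestronglyMeasurable]

/-- Although `condFactor` is defined at mean 0, any mean may be used; at the true mean the quadratic
bias terms vanish in expectation. -/
lemma log_condFactor (hS : S.PosDef) (hn : 1 ≤ n) (m : Obs d) (u : Sample d n) :
    Real.log (condFactor S u) = Real.log (iidDensity S m u) -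
      Real.log (gaussDensity S (Real.sqrt n • m) (suffStat u)) := by
  rw [iidDensity_eq_condFactor_mul hS hn, Real.log_mul (condFactor_pos hS u).ne'
    (gaussDensity_pos hS _ _).ne']
  ring

lemma integrable_log_condFactor (hS : S.PosDef) (hT : T.PosDef) (hn : 1 ≤ n) (m : Obs d) :
    Integrable (fun u => Real.log (condFactor S u)) (iidLaw T m n) := by
  simp_rw [log_condFactor hS hn m]
  exact (integrable_log_iidDensity hS m m).sub (integrable_log_gaussDensity_suffStat hS hT hn m _)

/-- Each of the n outcomes contributes one `meanLogLik T S`; Z has covariance T as well and takes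
one away. -/
lemma integral_log_condFactor (hS : S.PosDef) (hT : T.PosDef) (hn : 1 ≤ n) (m : Obs d) :
    ∫ u, Real.log (condFactor S u) ∂(iidLaw T m n) = ((n : ℝ) - 1) * meanLogLik T S := by
  simp_rw [log_condFactor hS hn m]
  rw [integral_sub (integrable_log_iidDensity hS m m)
    (integrable_log_gaussDensity_suffStat hS hT hn m _),
    integral_log_iidDensity hS hT.posSemidef, integral_log_gaussDensity_suffStat hS hT hn]
  simp [meanLogLik]
  ring

/-! ### The plug-in likelihood -/

lemma sum_pastOf {M : Type*} [AddCommMonoid M] (i : Fin n) (f : Fin n → M) :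
    ∑ j : Fin i, f (j.castLE i.isLt.le) = ∑ j ∈ Finset.Iio i, f j := by
  refine Finset.sum_nbij (fun j : Fin i => j.castLE i.isLt.le) ?_ ?_ ?_ ?_
  · intro j _
    simp only [Finset.mem_Iio]
    exact j.isLt
  · intro j _ k _ h
    exact Fin.castLE_injective _ h
  · intro j hj
    simp only [Finset.coe_Iio, Set.mem_Iio] at hj
    exact ⟨⟨j, hj⟩, by simp, rfl⟩
  · intro j _; rfl

/-- The coefficients of the prediction error of the plug-in estimator. -/
noncomputable def errCoeff (n₀ : ℝ) (i j : Fin n) : ℝ :=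
  if j = i then 1 else if j < i then -((i : ℝ) + n₀)⁻¹ else 0

/-- The function φ allows one computation for the coefficients and for their squares; φ 0 = 0
removes the outcomes after i. -/
lemma sum_errCoeff_smul {M : Type*} [AddCommGroup M] [Module ℝ M] (n₀ : ℝ) (i : Fin n)
    (φ : ℝ → ℝ) (hφ : φ 0 = 0) (f : Fin n → M) :
    ∑ j, φ (errCoeff n₀ i j) • f j =
      φ 1 • f i + φ (-((i : ℝ) + n₀)⁻¹) • ∑ j ∈ Finset.Iio i, f j := by
  have h : ∀ j, φ (errCoeff n₀ i j) • f j = (if j = i then φ 1 • f j else 0) +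
      (if j ∈ Finset.Iio i then φ (-((i : ℝ) + n₀)⁻¹) • f j else 0) := by
    intro j
    simp only [errCoeff, Finset.mem_Iio]
    rcases lt_trichotomy j i with h | h | h
    · simp [h, h.ne]
    · simp [h]
    · simp [h.ne', not_lt.2 h.le, hφ]
  simp_rw [h, Finset.sum_add_distrib]
  rw [Finset.sum_ite_eq' Finset.univ i, ← Finset.sum_filter, Finset.smul_sum]
  congr 1
  · simp
  · congr 1; ext j; simp

lemma sub_plugIn_eq (n₀ : ℝ) (x₀ : Obs d) (u : Sample d n) (i : Fin n) :
    u i - plugIn n₀ x₀ (pastOf u i) =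
      -(((i : ℝ) + n₀)⁻¹ * n₀) • x₀ + ∑ j, errCoeff n₀ i j • u j := by
  have h := sum_errCoeff_smul n₀ i id rfl u
  simp only [id] at h
  rw [h, plugIn]
  simp only [pastOf]
  rw [sum_pastOf i u]
  module

/-- The prediction error is an affine combination of outcomes: its coefficients sum to 1 - i/(i +
n₀) = n₀/(i + n₀), and their squares to 1 + i/(i + n₀)². -/
lemma map_sub_plugIn (hT : T.PosSemidef) {n₀ : ℝ} (hn₀ : 0 < n₀) (x₀ m : Obs d) (i : Fin n) :
    (iidLaw T m n).map (fun u => u i - plugIn n₀ x₀ (pastOf u i)) =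
      multivariateGaussian ((n₀ / ((i : ℝ) + n₀)) • (m - x₀))
        ((1 + (i : ℝ) / ((i : ℝ) + n₀) ^ 2) • T) := by
  have hpos : 0 < (i : ℝ) + n₀ := by positivity
  have h1 := sum_errCoeff_smul n₀ i id rfl (fun _ : Fin n => (1 : ℝ))
  have h2 := sum_errCoeff_smul n₀ i (fun x => x ^ 2) (by simp) (fun _ : Fin n => (1 : ℝ))
  simp only [id, smul_eq_mul, mul_one, Finset.sum_const, Fin.card_Iio, nsmul_eq_mul] at h1 h2
  simp_rw [sub_plugIn_eq]
  rw [map_affine_iidLaw hT, h1, h2]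
  congr 1
  · rw [smul_sub, sub_eq_add_neg, add_comm, neg_smul]
    congr 2
    · field_simp; ring
    · rw [div_eq_inv_mul]
  · congr 1; field_simp

lemma measurable_sub_plugIn (n₀ : ℝ) (x₀ : Obs d) (i : Fin n) :
    Measurable fun u : Sample d n => u i - plugIn n₀ x₀ (pastOf u i) := by
  simp_rw [sub_plugIn_eq]
  fun_prop

lemma log_plugInDensity (hS : S.PosDef) (n₀ : ℝ) (x₀ : Obs d) (u : Sample d n) :
    Real.log (plugInDensity S n₀ x₀ u) =
      ∑ i, (logNorm S - 1 / 2 * quadForm S⁻¹ (u i - plugIn n₀ x₀ (pastOf u i))) := by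
  rw [plugInDensity, Real.log_prod fun _ _ => (gaussDensity_pos hS _ _).ne']
  simp_rw [log_gaussDensity hS]

lemma integrable_quadForm_sub_plugIn (M : Matrix (Fin d) (Fin d) ℝ) (hT : T.PosSemidef)
    {n₀ : ℝ} (hn₀ : 0 < n₀) (x₀ m : Obs d) (i : Fin n) :
    Integrable (fun u => quadForm M (u i - plugIn n₀ x₀ (pastOf u i))) (iidLaw T m n) := by
  have h := integrable_quadForm_sub (S := (1 + (i : ℝ) / ((i : ℝ) + n₀) ^ 2) • T) M
    ((n₀ / ((i : ℝ) + n₀)) • (m - x₀)) 0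
  rw [← map_sub_plugIn hT hn₀] at h
  simp only [sub_zero] at h
  exact (integrable_map_measure (continuous_quadForm M).aestronglyMeasurable
    (measurable_sub_plugIn _ _ _).aemeasurable).1 h

lemma integral_quadForm_sub_plugIn (hT : T.PosSemidef)
    {n₀ : ℝ} (hn₀ : 0 < n₀) (x₀ m : Obs d) (i : Fin n) :
    ∫ u, quadForm S⁻¹ (u i - plugIn n₀ x₀ (pastOf u i)) ∂(iidLaw T m n) =
      effDim T S + effDim T S * ((i : ℝ) / ((i : ℝ) + n₀) ^ 2) +
        n₀ ^ 2 * quadForm S⁻¹ (m - x₀) * (1 / ((i : ℝ) + n₀) ^ 2) := by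
  have h := integral_quadForm_sub (S := (1 + (i : ℝ) / ((i : ℝ) + n₀) ^ 2) • T)
    (hT.smul (by positivity)) S⁻¹ ((n₀ / ((i : ℝ) + n₀)) • (m - x₀)) 0
  rw [← map_sub_plugIn hT hn₀] at h
  simp only [sub_zero] at h
  rw [integral_map (measurable_sub_plugIn _ _ _).aemeasurable
    (continuous_quadForm _).aestronglyMeasurable] at h
  rw [h, quadForm_smul, smul_mul_assoc, Matrix.trace_smul, effDim, smul_eq_mul, div_pow]
  ring

lemma integrable_log_plugInDensity (hS : S.PosDef) (hT : T.PosSemidef)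
    {n₀ : ℝ} (hn₀ : 0 < n₀) (x₀ m : Obs d) :
    Integrable (fun u => Real.log (plugInDensity S n₀ x₀ u)) (iidLaw T m n) := by
  simp_rw [log_plugInDensity hS]
  exact integrable_finsetSum _ fun i _ => (integrable_const _).sub
    ((integrable_quadForm_sub_plugIn _ hT hn₀ x₀ m i).const_mul _)

/-- Variance and squared bias of the estimator separate: the first sum is the variance part and
grows like log n, the second is the bias part and stays bounded. -/
lemma integral_log_plugInDensity (hS : S.PosDef) (hT : T.PosSemidef)
    {n₀ : ℝ} (hn₀ : 0 < n₀) (x₀ m : Obs d) :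
    ∫ u, Real.log (plugInDensity S n₀ x₀ u) ∂(iidLaw T m n) =
      n * meanLogLik T S -
        effDim T S / 2 * ∑ k ∈ Finset.range n, (k : ℝ) / ((k : ℝ) + n₀) ^ 2 -
        n₀ ^ 2 * quadForm S⁻¹ (m - x₀) / 2 *
          ∑ k ∈ Finset.range n, 1 / ((k : ℝ) + n₀) ^ 2 := by
  simp_rw [log_plugInDensity hS]
  have hi : ∀ i : Fin n, Integrable (fun u => logNorm S - 1 / 2 *
      quadForm S⁻¹ (u i - plugIn n₀ x₀ (pastOf u i))) (iidLaw T m n) := fun i =>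
    (integrable_const _).sub ((integrable_quadForm_sub_plugIn _ hT hn₀ x₀ m i).const_mul _)
  rw [integral_finsetSum _ fun i _ => hi i]
  have : ∀ i : Fin n, ∫ u, (logNorm S - 1 / 2 * quadForm S⁻¹ (u i - plugIn n₀ x₀ (pastOf u i)))
      ∂(iidLaw T m n) = meanLogLik T S - effDim T S / 2 * ((i : ℝ) / ((i : ℝ) + n₀) ^ 2) -
        n₀ ^ 2 * quadForm S⁻¹ (m - x₀) / 2 * (1 / ((i : ℝ) + n₀) ^ 2) := fun i => by
    rw [integral_sub (integrable_const _)
      ((integrable_quadForm_sub_plugIn _ hT hn₀ x₀ m i).const_mul _), integral_const_mul,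
      integral_quadForm_sub_plugIn hT hn₀]
    simp only [integral_const, probReal_univ, smul_eq_mul, meanLogLik]
    ring
  simp_rw [this]
  rw [Finset.sum_sub_distrib, Finset.sum_sub_distrib, Finset.mul_sum, Finset.mul_sum,
    Finset.sum_range, Finset.sum_range]
  simp

/-! ### Asymptotics -/

lemma summable_inv_sub_div_sq {n₀ : ℝ} (hn₀ : 0 < n₀) :
    Summable fun k : ℕ => (k : ℝ)⁻¹ - (k : ℝ) / ((k : ℝ) + n₀) ^ 2 := by
  refine Summable.of_norm_bounded (g := fun k : ℕ => (2 * n₀) * (1 / (k : ℝ) ^ 2))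
    ((Real.summable_one_div_nat_pow.2 (by norm_num)).mul_left _) fun k => ?_
  rcases Nat.eq_zero_or_pos k with rfl | hk
  · simp
  have hk : (0 : ℝ) < k := by exact_mod_cast hk
  have e : (k : ℝ)⁻¹ - (k : ℝ) / ((k : ℝ) + n₀) ^ 2 =
      n₀ * (2 * k + n₀) / (k * ((k : ℝ) + n₀) ^ 2) := by
    field_simp; ring
  rw [e, Real.norm_of_nonneg (by positivity), mul_one_div, div_le_div_iff₀ (by positivity)
    (by positivity)]
  -- This is the difference of the two cross-multiplied sides.
  have : 0 ≤ n₀ * k * (n₀ * (3 * k + 2 * n₀)) := by positivity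
  nlinarith

lemma isBigO_sum_div_sq_sub_log {n₀ : ℝ} (hn₀ : 0 < n₀) :
    (fun n : ℕ => ∑ k ∈ Finset.range n, (k : ℝ) / ((k : ℝ) + n₀) ^ 2 - Real.log n)
      =O[atTop] fun _ => (1 : ℝ) := by
  have h1 := (summable_inv_sub_div_sq hn₀).hasSum.tendsto_sum_nat
  have h2 := Real.tendsto_harmonic_sub_log
  have h3 : Tendsto (fun n : ℕ => (n : ℝ)⁻¹) atTop (𝓝 0) := tendsto_inv_atTop_nhds_zero_nat
  refine (((h2.sub h1).sub h3).isBigO_one ℝ).congr_left fun n => ?_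
  -- The sum stops at n - 1, and its term at k = 0 is 0 since 0⁻¹ = 0.
  have h4 : ∀ n : ℕ, (∑ k ∈ Finset.range n, (k : ℝ)⁻¹) = (harmonic n : ℝ) - (n : ℝ)⁻¹ := by
    intro n
    induction n with
    | zero => simp
    | succ n ih => rw [Finset.sum_range_succ, ih, harmonic_succ]; push_cast; ring
  rw [Finset.sum_sub_distrib, h4]
  ring

lemma isBigO_sum_one_div_sq {n₀ : ℝ} (hn₀ : 0 < n₀) :
    (fun n : ℕ => ∑ k ∈ Finset.range n, 1 / ((k : ℝ) + n₀) ^ 2) =O[atTop] fun _ => (1 : ℝ) := by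
  have h : Summable fun k : ℕ => 1 / ((k : ℝ) + n₀) ^ 2 := by
    refine ((Real.summable_one_div_nat_add_rpow n₀ 2).2 (by norm_num)).congr fun k => ?_
    rw [abs_of_pos (by positivity)]
    norm_num
  exact h.hasSum.tendsto_sum_nat.isBigO_one ℝ

/-- The multiples of `meanLogLik T S` differ by a single copy, so only the variance sum grows.
Keeping S and T separate covers both the alternative's own plug-in and the null's plug-in under data
from the alternative; c accommodates the constant left by the maximized likelihood. -/
lemma isBigO_integral_condFactor_sub_plugIn (hS : S.PosDef) (hT : T.PosDef)
    {n₀ : ℝ} (hn₀ : 0 < n₀) (x₀ m : Obs d) (c : ℝ) :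
    (fun n : ℕ => ∫ u, (Real.log (condFactor S u) + c - Real.log (plugInDensity S n₀ x₀ u))
      ∂(iidLaw T m n) - effDim T S / 2 * Real.log n) =O[atTop] fun _ => (1 : ℝ) := by
  have h1 := (isBigO_sum_div_sq_sub_log hn₀).const_mul_left (effDim T S / 2)
  have h2 := (isBigO_sum_one_div_sq hn₀).const_mul_left (n₀ ^ 2 * quadForm S⁻¹ (m - x₀) / 2)
  have h3 := Asymptotics.isBigO_const_const (c - meanLogLik T S) (one_ne_zero (α := ℝ))
    (atTop : Filter ℕ)
  refine ((h1.add h2).add h3).congr' ?_ EventuallyEq.rfl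
  filter_upwards [eventually_ge_atTop 1] with n hn
  have hi : Integrable (fun u => Real.log (condFactor S u) + c) (iidLaw T m n) :=
    (integrable_log_condFactor hS hT hn m).add (integrable_const c)
  rw [integral_sub hi
    (integrable_log_plugInDensity hS hT.posSemidef hn₀ x₀ m),
    integral_add (integrable_log_condFactor hS hT hn m) (integrable_const c),
    integral_log_condFactor hS hT hn,
    integral_log_plugInDensity hS hT.posSemidef hn₀]
  simp
  ring

end GaussTest

/-! ### Expected log-ratios, power of the conditional statistic, and effective dimension. -/

namespace GaussTest

variable {d n : ℕ} {S T C Sp Sq : Matrix (Fin d) (Fin d) ℝ}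

/-! ### Bayes marginals -/

lemma logNorm_smul (hS : S.PosDef) {c : ℝ} (hc : 0 < c) :
    logNorm (c • S) = logNorm S - d / 2 * Real.log c := by
  have h : (2 * Real.pi) ^ d * (c • S).det = c ^ d * ((2 * Real.pi) ^ d * S.det) := by
    rw [Matrix.det_smul, Fintype.card_fin]; ring
  have hdet := hS.det_pos
  rw [logNorm, h, Real.log_mul (by positivity) (by positivity), Real.log_pow, logNorm]
  ring

lemma inv_smul_posDef (hS : S.PosDef) {c : ℝ} (hc : 0 < c) : (c • S)⁻¹ = c⁻¹ • S⁻¹ := by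
  refine Matrix.inv_eq_right_inv ?_
  rw [Matrix.smul_mul, Matrix.mul_smul, smul_smul, mul_inv_cancel₀ hc.ne', one_smul,
    Matrix.mul_nonsing_inv _ (isUnit_iff_ne_zero.2 hS.det_pos.ne')]

lemma quadForm_matrix_smul (c : ℝ) (M : Matrix (Fin d) (Fin d) ℝ) (x : Obs d) :
    quadForm (c • M) x = c * quadForm M x := by
  simp [quadForm, Matrix.smul_mulVec]

/-- Write S + nC = n (S/n + C): the scalar n contributes -(d/2) log n through the determinant, and
the remaining terms converge because S/n + C → C with C invertible. -/
lemma isBigO_integral_log_gaussDensity_bayes (hT : T.PosDef) (hS : S.PosDef) (hC : C.PosDef)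
    (m m₁ : Obs d) :
    (fun n : ℕ => ∫ u, Real.log (gaussDensity (S + (n : ℝ) • C) (Real.sqrt n • m₁) (suffStat u))
      ∂(iidLaw T m n) + (d : ℝ) / 2 * Real.log n) =O[atTop] fun _ => (1 : ℝ) := by
  have h0 : Tendsto (fun n : ℕ => (n : ℝ)⁻¹) atTop (𝓝 0) := tendsto_inv_atTop_nhds_zero_nat
  have hA : Tendsto (fun n : ℕ => (n : ℝ)⁻¹ • S + C) atTop (𝓝 C) := by
    simpa using (h0.smul_const S).add_const C
  have hdet0 : (2 * Real.pi) ^ d * C.det ≠ 0 := by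
    have := hC.det_pos; positivity
  have hinv : ContinuousAt (fun A : Matrix (Fin d) (Fin d) ℝ => A⁻¹) C := by
    refine continuousAt_matrix_inv _ ?_
    rw [Ring.inverse_eq_inv']
    exact continuousAt_inv₀ hC.det_pos.ne'
  have hAinv : Tendsto (fun n : ℕ => ((n : ℝ)⁻¹ • S + C)⁻¹) atTop (𝓝 C⁻¹) :=
    hinv.tendsto.comp hA
  have hlog : Tendsto (fun n : ℕ => logNorm ((n : ℝ)⁻¹ • S + C)) atTop (𝓝 (logNorm C)) := by
    unfold logNorm
    refine Tendsto.const_mul _ (Tendsto.log ?_ hdet0)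
    exact Tendsto.const_mul _ ((Continuous.matrix_det continuous_id).tendsto C |>.comp hA)
  have htr : Tendsto (fun n : ℕ => (n : ℝ)⁻¹ * (T * ((n : ℝ)⁻¹ • S + C)⁻¹).trace) atTop
      (𝓝 (0 * (T * C⁻¹).trace)) := by
    refine h0.mul ?_
    have : Continuous fun A : Matrix (Fin d) (Fin d) ℝ => (T * A).trace :=
      (continuous_const.matrix_mul continuous_id).matrix_trace
    exact (this.tendsto _).comp hAinv
  have hq : Tendsto (fun n : ℕ => quadForm ((n : ℝ)⁻¹ • S + C)⁻¹ (m - m₁)) atTop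
      (𝓝 (quadForm C⁻¹ (m - m₁))) := by
    have : Continuous fun A : Matrix (Fin d) (Fin d) ℝ => quadForm A (m - m₁) := by
      unfold quadForm
      simp only [dotProduct, Matrix.mulVec]
      fun_prop
    exact (this.tendsto _).comp hAinv
  refine ((hlog.sub ((htr.add hq).const_mul (1 / 2))).isBigO_one ℝ).congr' ?_ EventuallyEq.rfl
  filter_upwards [eventually_ge_atTop 1] with n hn
  have hpos : (0 : ℝ) < n := by exact_mod_cast hn
  have hApd : ((n : ℝ)⁻¹ • S + C).PosDef := (hS.smul (inv_pos.2 hpos)).add hC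
  have hSn : S + (n : ℝ) • C = (n : ℝ) • ((n : ℝ)⁻¹ • S + C) := by
    rw [smul_add, smul_smul, mul_inv_cancel₀ hpos.ne', one_smul]
  rw [hSn, integral_log_gaussDensity_suffStat (hApd.smul hpos) hT hn, logNorm_smul hApd hpos,
    effDim, inv_smul_posDef hApd hpos, Matrix.mul_smul, Matrix.trace_smul, ← smul_sub,
    quadForm_smul, quadForm_matrix_smul, Real.sq_sqrt hpos.le, smul_eq_mul]
  field_simp
  ring

/-! ### The statistics -/

lemma effDim_self (hS : S.PosDef) : effDim S S = d := by
  rw [effDim, Matrix.mul_nonsing_inv _ (isUnit_iff_ne_zero.2 hS.det_pos.ne')]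
  simp

lemma plugInDensity_pos (hS : S.PosDef) (n₀ : ℝ) (x₀ : Obs d) (u : Sample d n) :
    0 < plugInDensity S n₀ x₀ u :=
  Finset.prod_pos fun _ _ => gaussDensity_pos hS _ _

lemma log_condStat_ae_eq (hSp : Sp.PosDef) (hSq : Sq.PosDef) (hn : 1 ≤ n) (a b : Obs d) :
    (fun u : Sample d n => Real.log (condStat Sp Sq a b u)) =ᵐ[volume]
      fun u => Real.log (condFactor Sq u) - Real.log (condFactor Sp u) := by
  filter_upwards [condStat_ae_eq hSp hSq hn a b] with u hu
  rw [hu, Real.log_div (condFactor_pos hSq u).ne' (condFactor_pos hSp u).ne']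

/-- The null's `condFactor` occurs both in the conditional statistic and in the maximized likelihood
and cancels, leaving only `logNorm Sp` from the null. -/
lemma log_condStat_div_plugInUI_ae_eq (hSp : Sp.PosDef) (hSq : Sq.PosDef) (hn : 1 ≤ n)
    (a b : Obs d) (n₀ : ℝ) (x₀ : Obs d) :
    (fun u : Sample d n => Real.log (condStat Sp Sq a b u / plugInUI Sp Sq n₀ x₀ u))
      =ᵐ[volume] fun u => Real.log (condFactor Sq u) + logNorm Sp -
        Real.log (plugInDensity Sq n₀ x₀ u) := by
  filter_upwards [condStat_ae_eq hSp hSq hn a b] with u hu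
  have h1 := (condFactor_pos hSq u).ne'
  have h2 := (condFactor_pos hSp u).ne'
  have h3 := (plugInDensity_pos hSq n₀ x₀ u).ne'
  have e : condStat Sp Sq a b u / plugInUI Sp Sq n₀ x₀ u =
      condFactor Sq u * Real.exp (logNorm Sp) / plugInDensity Sq n₀ x₀ u := by
    rw [hu, plugInUI, maxLikelihood_eq hSp hn]
    field_simp
  rw [e, Real.log_div (mul_ne_zero h1 (Real.exp_ne_zero _)) h3,
    Real.log_mul h1 (Real.exp_ne_zero _), Real.log_exp]

lemma log_bayesUI_div_plugInUI_ae_eq (hSp : Sp.PosDef) (hSq : Sq.PosDef) (hC : C.PosDef)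
    (hn : 1 ≤ n) (m₁ : Obs d) (n₀ : ℝ) (x₀ : Obs d) :
    (fun u : Sample d n => Real.log (bayesUI Sp Sq m₁ C u / plugInUI Sp Sq n₀ x₀ u))
      =ᵐ[volume] fun u => (Real.log (condFactor Sq u) + 0 - Real.log (plugInDensity Sq n₀ x₀ u)) +
        Real.log (gaussDensity (Sq + (n : ℝ) • C) (Real.sqrt n • m₁) (suffStat u)) := by
  filter_upwards [bayesDensity_ae_eq hSq hC.posSemidef hn m₁] with u hu
  have h1 := (condFactor_pos hSq u).ne'
  have h2 := (condFactor_pos hSp u).ne'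
  have h3 := (plugInDensity_pos hSq n₀ x₀ u).ne'
  have h4 := (gaussDensity_pos (hSq.add_posSemidef
    (hC.posSemidef.smul (Nat.cast_nonneg n : (0 : ℝ) ≤ n))) (Real.sqrt n • m₁) (suffStat u)).ne'
  have e : bayesUI Sp Sq m₁ C u / plugInUI Sp Sq n₀ x₀ u = condFactor Sq u /
      plugInDensity Sq n₀ x₀ u *
        gaussDensity (Sq + (n : ℝ) • C) (Real.sqrt n • m₁) (suffStat u) := by
    rw [bayesUI, hu, plugInUI, maxLikelihood_eq hSp hn]
    field_simp
  rw [e, Real.log_mul (div_ne_zero h1 h3) h4, Real.log_div h1 h3, add_zero]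

lemma integrable_condFactor_sub_plugIn (hS : S.PosDef) (hT : T.PosDef) (hn : 1 ≤ n)
    {n₀ : ℝ} (hn₀ : 0 < n₀) (x₀ m : Obs d) (c : ℝ) :
    Integrable (fun u => Real.log (condFactor S u) + c - Real.log (plugInDensity S n₀ x₀ u))
      (iidLaw T m n) :=
  ((integrable_log_condFactor hS hT hn m).add (integrable_const c)).sub
    (integrable_log_plugInDensity hS hT.posSemidef hn₀ x₀ m)

theorem bayesUI_asymptotics (hSp : Sp.PosDef) (hSq : Sq.PosDef) (hC : C.PosDef) (m m₁ : Obs d)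
    {n₀ : ℝ} (hn₀ : 0 < n₀) (x₀ : Obs d) :
    (∀ n : ℕ, 1 ≤ n → Integrable (fun u => Real.log (bayesUI Sp Sq m₁ C u /
        plugInUI Sp Sq n₀ x₀ u)) (iidLaw Sq m n)) ∧
      (fun n : ℕ => ∫ u, Real.log (bayesUI Sp Sq m₁ C u /
        plugInUI Sp Sq n₀ x₀ u) ∂(iidLaw Sq m n)) =O[atTop] (fun _ => (1 : ℝ)) := by
  have hae : ∀ n : ℕ, 1 ≤ n → _ := fun n hn => (iidLaw_absolutelyContinuous_volume hSq m n).ae_eq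
    (log_bayesUI_div_plugInUI_ae_eq hSp hSq hC hn m₁ n₀ x₀)
  have hi1 : ∀ n : ℕ, 1 ≤ n → Integrable _ (iidLaw Sq m n) := fun n hn =>
    integrable_condFactor_sub_plugIn hSq hSq hn hn₀ x₀ m 0
  have hi2 : ∀ n : ℕ, 1 ≤ n → Integrable (fun u => Real.log (gaussDensity (Sq + (n : ℝ) • C)
      (Real.sqrt n • m₁) (suffStat u))) (iidLaw Sq m n) := fun n hn =>
    integrable_log_gaussDensity_suffStat (hSq.add_posSemidef
      (hC.posSemidef.smul (Nat.cast_nonneg n : (0 : ℝ) ≤ n))) hSq hn m _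
  refine ⟨fun n hn => ((hi1 n hn).add (hi2 n hn)).congr (hae n hn).symm, ?_⟩
  have h1 := isBigO_integral_condFactor_sub_plugIn hSq hSq hn₀ x₀ m 0
  have h2 := isBigO_integral_log_gaussDensity_bayes hSq hSq hC m m₁
  refine (h1.add h2).congr' ?_ EventuallyEq.rfl
  filter_upwards [eventually_ge_atTop 1] with n hn
  rw [integral_congr_ae (hae n hn), integral_add (hi1 n hn) (hi2 n hn), effDim_self hSq]
  ring

theorem condStat_div_plugInUI_asymptotics (hSp : Sp.PosDef) (hSq : Sq.PosDef) (m a b : Obs d)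
    {n₀ : ℝ} (hn₀ : 0 < n₀) (x₀ : Obs d) :
    (∀ n : ℕ, 1 ≤ n → Integrable (fun u => Real.log (condStat Sp Sq a b u /
        plugInUI Sp Sq n₀ x₀ u)) (iidLaw Sq m n)) ∧
      (fun n : ℕ => (∫ u, Real.log (condStat Sp Sq a b u /
        plugInUI Sp Sq n₀ x₀ u) ∂(iidLaw Sq m n)) - (d : ℝ) / 2 * Real.log n)
        =O[atTop] (fun _ => (1 : ℝ)) := by
  have hae : ∀ n : ℕ, 1 ≤ n → _ := fun n hn => (iidLaw_absolutelyContinuous_volume hSq m n).ae_eq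
    (log_condStat_div_plugInUI_ae_eq hSp hSq hn a b n₀ x₀)
  refine ⟨fun n hn => (integrable_condFactor_sub_plugIn hSq hSq hn hn₀ x₀ m _).congr
    (hae n hn).symm, ?_⟩
  refine (isBigO_integral_condFactor_sub_plugIn hSq hSq hn₀ x₀ m (logNorm Sp)).congr' ?_
    EventuallyEq.rfl
  filter_upwards [eventually_ge_atTop 1] with n hn
  rw [integral_congr_ae (hae n hn), effDim_self hSq]

/-! ### Kullback-Leibler divergence of densities -/

section KL

variable {α : Type*} [MeasurableSpace α] {ν : Measure α} {f g : α → ℝ}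

lemma llr_ofDensity [SFinite ν] (hf : Measurable f) (hg : Measurable g) (hfpos : ∀ x, 0 < f x)
    (hgpos : ∀ x, 0 < g x) [SigmaFinite (ofDensity ν g)] :
    llr (ofDensity ν f) (ofDensity ν g) =ᵐ[ν] fun x => Real.log (f x) - Real.log (g x) := by
  have h := Measure.rnDeriv_withDensity (ofDensity ν g) (hf.div hg).ennreal_ofReal
  filter_upwards [(absolutelyContinuous_ofDensity hg hgpos).ae_le h] with x hx
  rw [llr, ofDensity_eq_withDensity_div hf hg hgpos]
  simp only [Pi.div_apply] at hx
  rw [hx, ENNReal.toReal_ofReal (div_pos (hfpos x) (hgpos x)).le,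
    Real.log_div (hfpos x).ne' (hgpos x).ne']

lemma ofDensity_absolutelyContinuous_ofDensity (hg : Measurable g) (hgpos : ∀ x, 0 < g x) :
    ofDensity ν f ≪ ofDensity ν g :=
  ofDensity_absolutelyContinuous.trans (absolutelyContinuous_ofDensity hg hgpos)

end KL

/-- The difference is the divergence of N(0, Sq) from N(0, Sp). If it vanished, the laws and hence
their covariances would agree. -/
lemma meanLogLik_lt (hSp : Sp.PosDef) (hSq : Sq.PosDef) (hne : Sq ≠ Sp) :
    meanLogLik Sq Sp < meanLogLik Sq Sq := by
  have hac : multivariateGaussian 0 Sq ≪ multivariateGaussian 0 Sp := by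
    rw [multivariateGaussian_eq_ofDensity hSq, multivariateGaussian_eq_ofDensity hSp]
    exact ofDensity_absolutelyContinuous_ofDensity (measurable_gaussDensity 0)
      (gaussDensity_pos hSp 0)
  have hllr : llr (multivariateGaussian 0 Sq) (multivariateGaussian 0 Sp)
      =ᵐ[multivariateGaussian 0 Sq] fun x => Real.log (gaussDensity Sq 0 x) -
        Real.log (gaussDensity Sp 0 x) := by
    have h : multivariateGaussian 0 Sq ≪ volume := by
      rw [multivariateGaussian_eq_ofDensity hSq]; exact ofDensity_absolutelyContinuous
    refine h.ae_le ?_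
    have : IsProbabilityMeasure (ofDensity volume (gaussDensity Sp 0)) := by
      rw [← multivariateGaussian_eq_ofDensity hSp]; infer_instance
    rw [multivariateGaussian_eq_ofDensity hSq, multivariateGaussian_eq_ofDensity hSp]
    exact llr_ofDensity (measurable_gaussDensity 0) (measurable_gaussDensity 0)
      (gaussDensity_pos hSq 0) (gaussDensity_pos hSp 0)
  have hi : Integrable (llr (multivariateGaussian 0 Sq) (multivariateGaussian 0 Sp))
      (multivariateGaussian 0 Sq) :=
    ((integrable_log_gaussDensity hSq 0 0).sub (integrable_log_gaussDensity hSp 0 0)).congr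
      hllr.symm
  have hkl := toReal_klDiv_of_measure_eq hac (by simp)
  rw [integral_congr_ae hllr, integral_sub (integrable_log_gaussDensity hSq 0 0)
    (integrable_log_gaussDensity hSp 0 0), integral_log_gaussDensity hSq hSq.posSemidef,
    integral_log_gaussDensity hSp hSq.posSemidef] at hkl
  have hpos : 0 < (klDiv (multivariateGaussian 0 Sq) (multivariateGaussian 0 Sp)).toReal := by
    refine ENNReal.toReal_pos (fun h => hne ?_) (klDiv_ne_top hac hi)
    have heq := klDiv_eq_zero_iff.1 h
    ext i j
    rw [← covariance_eval_multivariateGaussian (μ := 0) hSq.posSemidef i j,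
      ← covariance_eval_multivariateGaussian (μ := 0) hSp.posSemidef i j, heq]
  simp [meanLogLik] at *
  linarith

theorem condStat_power (hSp : Sp.PosDef) (hSq : Sq.PosDef) (hne : Sq ≠ Sp) (m a b : Obs d) :
    ∃ ε : ℝ, 0 < ε ∧ ∀ n : ℕ, 1 < n →
      Integrable (fun u => Real.log (condStat Sp Sq a b u)) (iidLaw Sq m n) ∧
      (n : ℝ) * ε < ∫ u, Real.log (condStat Sp Sq a b u) ∂(iidLaw Sq m n) := by
  have hlt := meanLogLik_lt hSp hSq hne
  -- The expectation is (n - 1)Δ with Δ the gap in `meanLogLik`, and n - 1 ≥ n/2 > n/3 for n ≥ 2.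
  refine ⟨(meanLogLik Sq Sq - meanLogLik Sq Sp) / 3, by linarith, fun n hn => ?_⟩
  have hae := (iidLaw_absolutelyContinuous_volume hSq m n).ae_eq
    (log_condStat_ae_eq hSp hSq hn.le a b)
  have hi1 := integrable_log_condFactor hSq hSq hn.le m
  have hi2 := integrable_log_condFactor hSp hSq hn.le m
  refine ⟨(hi1.sub hi2).congr hae.symm, ?_⟩
  rw [integral_congr_ae hae, integral_sub hi1 hi2, integral_log_condFactor hSq hSq hn.le,
    integral_log_condFactor hSp hSq hn.le]
  have : (2 : ℝ) ≤ n := by exact_mod_cast hn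
  nlinarith

/-- The deficit d - tr(Sq Sp⁻¹) is the mean of the nonnegative form of Sp⁻¹ under N(0, Sp - Sq). -/
lemma effDim_le (hSp : Sp.PosDef) (h : (Sp - Sq).PosSemidef) : effDim Sq Sp ≤ d := by
  have h1 : 0 ≤ effDim (Sp - Sq) Sp := by
    have := integral_quadForm_sub h Sp⁻¹ 0 0
    rw [sub_zero, quadForm_zero, add_zero] at this
    rw [effDim, ← this]
    exact integral_nonneg fun x => quadForm_nonneg hSp.inv.posSemidef _
  rw [effDim, sub_mul, Matrix.trace_sub] at h1
  have h2 := effDim_self hSp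
  rw [effDim] at h2 ⊢
  linarith

open scoped MatrixOrder in
-- With B = Sp^{-1/2} the deficit is the trace of the positive semidefinite matrix B (Sp - Sq) B.
-- Zero trace would force this matrix to vanish, but its determinant is nonzero.
lemma effDim_lt [Nonempty (Fin d)] (hSp : Sp.PosDef) (h : (Sp - Sq).PosDef) :
    effDim Sq Sp < d := by
  set B := CFC.sqrt Sp⁻¹ with hB
  have hBB : B * B = Sp⁻¹ := CFC.sqrt_mul_sqrt_self _ hSp.inv.posSemidef.nonneg
  have hBsymm : Bᴴ = B :=
    (Matrix.nonneg_iff_posSemidef.1 (CFC.sqrt_nonneg Sp⁻¹) : B.PosSemidef).isHermitian.eq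
  have hpsd : (B * (Sp - Sq) * B).PosSemidef := by
    have := h.posSemidef.mul_mul_conjTranspose_same B
    rwa [hBsymm] at this
  have htr : (B * (Sp - Sq) * B).trace = effDim Sp Sp - effDim Sq Sp := by
    rw [Matrix.trace_mul_comm, ← mul_assoc, hBB, Matrix.trace_mul_comm, sub_mul,
      Matrix.trace_sub, effDim, effDim]
  refine (effDim_le hSp h.posSemidef).lt_of_ne fun heq => ?_
  rw [effDim_self hSp, heq, sub_self, hpsd.trace_eq_zero_iff] at htr
  have hdet := congrArg Matrix.det htr
  have hB0 : B.det * B.det ≠ 0 := by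
    rw [← Matrix.det_mul, hBB]; exact hSp.inv.det_pos.ne'
  rw [Matrix.det_mul, Matrix.det_mul, Matrix.det_zero] at hdet
  rcases mul_eq_zero.1 hdet with h0 | h0
  · rcases mul_eq_zero.1 h0 with h1 | h1
    · exact hB0 (by rw [h1, zero_mul])
    · exact h.det_pos.ne' h1
  · exact hB0 (by rw [h0, zero_mul])

end GaussTest

/-! ### Reverse information projections: uniqueness and a sufficient criterion. -/

namespace GaussTest

section RIPr

variable {α : Type*} [MeasurableSpace α] {ν : Measure α} {f g p q : α → ℝ} {𝓕 : Set (α → ℝ)}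

/-- Measurable, everywhere positive probability densities relative to `ν`. -/
structure IsPosDensity (ν : Measure α) (f : α → ℝ) : Prop where
  measurable : Measurable f
  pos : ∀ x, 0 < f x
  lintegral_eq_one : ∫⁻ x, ENNReal.ofReal (f x) ∂ν = 1

lemma IsPosDensity.isProbabilityMeasure (hf : IsPosDensity ν f) :
    IsProbabilityMeasure (ofDensity ν f) := by
  refine ⟨?_⟩
  rw [ofDensity, withDensity_apply _ MeasurableSet.univ, Measure.restrict_univ,
    hf.lintegral_eq_one]

lemma isPosDensity_of_isProbabilityMeasure (hm : Measurable f) (hpos : ∀ x, 0 < f x)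
    (h : IsProbabilityMeasure (ofDensity ν f)) : IsPosDensity ν f := by
  refine ⟨hm, hpos, ?_⟩
  have := h.measure_univ
  rwa [ofDensity, withDensity_apply _ MeasurableSet.univ, Measure.restrict_univ] at this

lemma convex_isPosDensity : Convex ℝ {f : α → ℝ | IsPosDensity ν f} := by
  intro f hf g hg a b ha hb hab
  refine ⟨(hf.measurable.const_smul a).add (hg.measurable.const_smul b), fun x => ?_, ?_⟩
  · have h1 := hf.pos x
    have h2 := hg.pos x
    simp only [Pi.add_apply, Pi.smul_apply, smul_eq_mul]
    rcases ha.eq_or_lt with rfl | ha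
    · have : b = 1 := by linarith
      simp [this, h2]
    · positivity
  · have : ∀ x, ENNReal.ofReal ((a • f + b • g) x) =
        ENNReal.ofReal a * ENNReal.ofReal (f x) + ENNReal.ofReal b * ENNReal.ofReal (g x) := by
      intro x
      rw [← ENNReal.ofReal_mul ha, ← ENNReal.ofReal_mul hb, ← ENNReal.ofReal_add
        (mul_nonneg ha (hf.pos x).le) (mul_nonneg hb (hg.pos x).le)]
      rfl
    simp_rw [this]
    rw [lintegral_add_left (hf.measurable.ennreal_ofReal.const_mul _),
      lintegral_const_mul _ hf.measurable.ennreal_ofReal,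
      lintegral_const_mul _ hg.measurable.ennreal_ofReal, hf.lintegral_eq_one,
      hg.lintegral_eq_one, mul_one, mul_one, ← ENNReal.ofReal_add ha hb, hab, ENNReal.ofReal_one]

lemma isPosDensity_of_mem_convexHull (h𝓕 : ∀ f ∈ 𝓕, IsPosDensity ν f)
    (hf : f ∈ convexHull ℝ 𝓕) : IsPosDensity ν f :=
  convexHull_min (t := {f | IsPosDensity ν f}) h𝓕 convex_isPosDensity hf

/-- The constraint is linear in f on nonnegative measurable functions, so it passes to convex
combinations. -/
lemma lintegral_div_le_one_of_mem_convexHull {Q : Measure α} (h𝓕 : ∀ f ∈ 𝓕, IsPosDensity ν f)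
    (hp : IsPosDensity ν p) (hle : ∀ f ∈ 𝓕, ∫⁻ x, ENNReal.ofReal (f x / p x) ∂Q ≤ 1)
    (hf : f ∈ convexHull ℝ 𝓕) : ∫⁻ x, ENNReal.ofReal (f x / p x) ∂Q ≤ 1 := by
  have hconv : Convex ℝ {f : α → ℝ | Measurable f ∧ (∀ x, 0 ≤ f x) ∧
      ∫⁻ x, ENNReal.ofReal (f x / p x) ∂Q ≤ 1} := by
    intro f hf g hg a b ha hb hab
    have h1 : ∀ x, 0 ≤ f x / p x := fun x => div_nonneg (hf.2.1 x) (hp.pos x).le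
    have h2 : ∀ x, 0 ≤ g x / p x := fun x => div_nonneg (hg.2.1 x) (hp.pos x).le
    refine ⟨(hf.1.const_smul a).add (hg.1.const_smul b), fun x => ?_, ?_⟩
    · exact add_nonneg (mul_nonneg ha (hf.2.1 x)) (mul_nonneg hb (hg.2.1 x))
    · have : ∀ x, ENNReal.ofReal ((a • f + b • g) x / p x) =
          ENNReal.ofReal a * ENNReal.ofReal (f x / p x) +
            ENNReal.ofReal b * ENNReal.ofReal (g x / p x) := by
        intro x
        rw [← ENNReal.ofReal_mul ha, ← ENNReal.ofReal_mul hb, ← ENNReal.ofReal_add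
          (mul_nonneg ha (h1 x)) (mul_nonneg hb (h2 x))]
        congr 1
        simp only [Pi.add_apply, Pi.smul_apply, smul_eq_mul]
        ring
      simp_rw [this]
      have m1 : Measurable fun x => ENNReal.ofReal (f x / p x) :=
        (hf.1.div hp.measurable).ennreal_ofReal
      have m2 : Measurable fun x => ENNReal.ofReal (g x / p x) :=
        (hg.1.div hp.measurable).ennreal_ofReal
      rw [lintegral_add_left (m1.const_mul _), lintegral_const_mul _ m1, lintegral_const_mul _ m2]
      calc _ ≤ ENNReal.ofReal a * 1 + ENNReal.ofReal b * 1 := by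
            gcongr
            exacts [hf.2.2, hg.2.2]
        _ = 1 := by rw [mul_one, mul_one, ← ENNReal.ofReal_add ha hb, hab, ENNReal.ofReal_one]
  exact (convexHull_min (t := {f : α → ℝ | Measurable f ∧ (∀ x, 0 ≤ f x) ∧
      ∫⁻ x, ENNReal.ofReal (f x / p x) ∂Q ≤ 1}) (fun f hf => ⟨(h𝓕 f hf).measurable, fun x => ((h𝓕 f hf).pos x).le,
    hle f hf⟩) hconv hf).2.2

/-- With w = e^{t/2}, the bound t/2 ≤ w - 1 gives (w - 1)² ≤ e^t - 1 - t and |t| ≤ (e^t - 1 - t) +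
2|w - 1|; the last term is split by the arithmetic-geometric mean inequality. The purpose is to
control |log h| in mean by the defect in Jensen's inequality. -/
lemma abs_le_add_mul_exp_sub (t : ℝ) {ε : ℝ} (hε : 0 < ε) :
    |t| ≤ ε + (1 + ε⁻¹) * (Real.exp t - 1 - t) := by
  set w := Real.exp (t / 2) with hw
  have hw0 : 0 < w := Real.exp_pos _
  have hw2 : Real.exp t = w ^ 2 := by rw [hw, ← Real.exp_nat_mul]; congr 1; push_cast; ring
  have h1 : t / 2 + 1 ≤ w := Real.add_one_le_exp _
  have hφ : (w - 1) ^ 2 ≤ Real.exp t - 1 - t := by rw [hw2]; nlinarith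
  have h2 : 2 * |w - 1| ≤ ε + ε⁻¹ * (w - 1) ^ 2 := by
    have : 0 ≤ ε⁻¹ * (ε - |w - 1|) ^ 2 := by positivity
    rw [sub_sq, sq_abs] at this
    field_simp at this ⊢
    linarith
  have h3 : |t| ≤ (Real.exp t - 1 - t) + 2 * |w - 1| := by
    rcases le_or_gt 0 t with ht | ht
    · rw [abs_of_nonneg ht]
      have := le_abs_self (w - 1)
      have := sq_nonneg (w - 1)
      linarith
    · rw [abs_of_neg ht, hw2]
      have hw1 : w < 1 := by rw [hw]; exact Real.exp_lt_one_iff.2 (by linarith)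
      rw [abs_of_neg (by linarith)]
      nlinarith
  have h4 : ε⁻¹ * (w - 1) ^ 2 ≤ ε⁻¹ * (Real.exp t - 1 - t) := by gcongr
  linarith

/-- Put t = log h in the pointwise bound: since E h ≤ 1, the mean of e^t - 1 - t is at most -E log
h. A small divergence gap thus yields L¹ closeness of logarithms. -/
lemma integral_abs_log_le {Q : Measure α} [IsProbabilityMeasure Q] {h : α → ℝ}
    (hm : Measurable h) (hpos : ∀ x, 0 < h x) (hle : ∫⁻ x, ENNReal.ofReal (h x) ∂Q ≤ 1)
    (hint : Integrable (fun x => Real.log (h x)) Q) {ε : ℝ} (hε : 0 < ε) :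
    ∫ x, |Real.log (h x)| ∂Q ≤ ε + (1 + ε⁻¹) * -∫ x, Real.log (h x) ∂Q := by
  have hi : Integrable h Q := by
    refine ⟨hm.aestronglyMeasurable, ?_⟩
    rw [hasFiniteIntegral_iff_ofReal (ae_of_all _ fun x => (hpos x).le)]
    exact hle.trans_lt ENNReal.one_lt_top
  have h1 : ∫ x, h x ∂Q ≤ 1 := by
    rw [integral_eq_lintegral_of_nonneg_ae (ae_of_all _ fun x => (hpos x).le)
      hm.aestronglyMeasurable]
    exact ENNReal.toReal_le_of_le_ofReal zero_le_one (by simpa using hle)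
  have hi3 : Integrable (fun x => h x - 1) Q := hi.sub (integrable_const 1)
  have hi2 : Integrable (fun x => h x - 1 - Real.log (h x)) Q :=
    hi3.sub hint
  calc ∫ x, |Real.log (h x)| ∂Q
      ≤ ∫ x, (ε + (1 + ε⁻¹) * (h x - 1 - Real.log (h x))) ∂Q := by
        refine integral_mono hint.abs ((integrable_const _).add (hi2.const_mul _)) fun x => ?_
        have := abs_le_add_mul_exp_sub (Real.log (h x)) hε
        rwa [Real.exp_log (hpos x)] at this
    _ = ε + (1 + ε⁻¹) * ((∫ x, h x ∂Q) - 1 - ∫ x, Real.log (h x) ∂Q) := by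
        rw [integral_add (integrable_const _) (hi2.const_mul _), integral_const_mul,
          integral_sub hi3 hint, integral_sub hi (integrable_const 1)]
        simp
    _ ≤ _ := by
        have : 0 < 1 + ε⁻¹ := by positivity
        gcongr
        linarith

lemma integral_log_nonpos {Q : Measure α} [IsProbabilityMeasure Q] {h : α → ℝ}
    (hm : Measurable h) (hpos : ∀ x, 0 < h x) (hle : ∫⁻ x, ENNReal.ofReal (h x) ∂Q ≤ 1)
    (hint : Integrable (fun x => Real.log (h x)) Q) : ∫ x, Real.log (h x) ∂Q ≤ 0 := by
  by_contra! hc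
  -- With ε equal to the supposed positive integral c, the bound is c - (1 + 1/c)c = -1, impossible
  -- for a nonnegative integral.
  have h1 := integral_abs_log_le hm hpos hle hint hc
  have h2 : 0 ≤ ∫ x, |Real.log (h x)| ∂Q := integral_nonneg fun x => abs_nonneg _
  have h3 := inv_mul_cancel₀ hc.ne'
  have h4 : (1 + (∫ x, Real.log (h x) ∂Q)⁻¹) * -∫ x, Real.log (h x) ∂Q =
    - (∫ x, Real.log (h x) ∂Q) - 1 := by rw [add_mul, mul_neg, mul_neg, h3]; ring
  linarith

/-- The reverse information projection is unique up to null sets. -/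
theorem IsRIPr.ae_eq {p' : α → ℝ} (h𝓕 : ∀ f ∈ 𝓕, IsPosDensity ν f) (hne : 𝓕.Nonempty)
    (hp : IsRIPr ν q 𝓕 p) (hp' : IsRIPr ν q 𝓕 p') : p =ᵐ[ofDensity ν q] p' := by
  set F : (α → ℝ) → ℝ≥0∞ := fun g => klDiv (ofDensity ν q) (ofDensity ν g) with hF
  -- A minimizing sequence exists in the hull, and its logarithms converge in L¹(Q) to both log p
  -- and log p'.
  obtain ⟨a, -, ha, hmem⟩ := exists_seq_tendsto_sInf (S := F '' convexHull ℝ 𝓕)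
    (hne.convexHull.image F) (OrderBot.bddBelow _)
  choose f hf hfa using hmem
  rw [sInf_image] at ha
  have hlim : Tendsto (fun j => klDiv (ofDensity ν q) (ofDensity ν (f j))) atTop
      (𝓝 (⨅ g ∈ convexHull ℝ 𝓕, klDiv (ofDensity ν q) (ofDensity ν g))) := by
    obtain rfl : (fun n => F (f n)) = a := funext hfa
    exact ha
  have h1 := hp.tendsto_log f hf hlim
  have h2 := hp'.tendsto_log f hf hlim
  have hmeas : ∀ j, Measurable fun x => Real.log (f j x) := fun j =>
    Real.measurable_log.comp (isPosDensity_of_mem_convexHull h𝓕 (hf j)).measurable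
  have hl : Measurable fun x => Real.log (p x) := Real.measurable_log.comp hp.measurable
  have hl' : Measurable fun x => Real.log (p' x) := Real.measurable_log.comp hp'.measurable
  have h3 : ∀ j, ∫⁻ x, ‖Real.log (p x) - Real.log (p' x)‖ₑ ∂(ofDensity ν q) ≤
      ∫⁻ x, ‖Real.log (f j x) - Real.log (p x)‖ₑ ∂(ofDensity ν q) +
        ∫⁻ x, ‖Real.log (f j x) - Real.log (p' x)‖ₑ ∂(ofDensity ν q) := fun j => by
    have m1 : Measurable fun x => ‖Real.log (f j x) - Real.log (p x)‖ₑ := ((hmeas j).sub hl).enorm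
    rw [← lintegral_add_left m1]
    refine lintegral_mono fun x => ?_
    have : Real.log (p x) - Real.log (p' x) = -(Real.log (f j x) - Real.log (p x)) +
        (Real.log (f j x) - Real.log (p' x)) := by ring
    rw [this]
    refine (enorm_add_le _ _).trans ?_
    rw [enorm_neg]
  have h4 := le_antisymm (ge_of_tendsto' (h1.add h2) h3) (by simp)
  have m2 : Measurable fun x => ‖Real.log (p x) - Real.log (p' x)‖ₑ := (hl.sub hl').enorm
  rw [add_zero, lintegral_eq_zero_iff m2] at h4
  filter_upwards [h4, hp.pos, hp'.pos] with x hx hx1 hx2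
  simp only [Pi.zero_apply, enorm_eq_zero, sub_eq_zero] at hx
  exact Real.log_injOn_pos hx1 hx2 hx

variable [SFinite ν]

lemma llr_ae_eq (hq : IsPosDensity ν q) (hf : IsPosDensity ν f) :
    llr (ofDensity ν q) (ofDensity ν f) =ᵐ[ofDensity ν q]
      fun x => Real.log (q x) - Real.log (f x) := by
  have := hf.isProbabilityMeasure
  exact ofDensity_absolutelyContinuous.ae_eq (llr_ofDensity hq.measurable hf.measurable hq.pos hf.pos)

lemma klDiv_ofDensity (hq : IsPosDensity ν q) (hf : IsPosDensity ν f)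
    (hint : Integrable (fun x => Real.log (q x) - Real.log (f x)) (ofDensity ν q)) :
    klDiv (ofDensity ν q) (ofDensity ν f) =
      ENNReal.ofReal (∫ x, (Real.log (q x) - Real.log (f x)) ∂(ofDensity ν q)) := by
  have := hf.isProbabilityMeasure
  have := hq.isProbabilityMeasure
  rw [klDiv_of_ac_of_integrable (ofDensity_absolutelyContinuous_ofDensity hf.measurable hf.pos)
    (hint.congr (llr_ae_eq hq hf).symm), integral_congr_ae (llr_ae_eq hq hf)]
  simp

lemma integrable_of_klDiv_ne_top (hq : IsPosDensity ν q) (hf : IsPosDensity ν f)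
    (h : klDiv (ofDensity ν q) (ofDensity ν f) ≠ ∞) :
    Integrable (fun x => Real.log (q x) - Real.log (f x)) (ofDensity ν q) :=
  (klDiv_ne_top_iff.1 h).2.congr (llr_ae_eq hq hf)

lemma toReal_klDiv_ofDensity (hq : IsPosDensity ν q) (hf : IsPosDensity ν f) :
    (klDiv (ofDensity ν q) (ofDensity ν f)).toReal =
      ∫ x, (Real.log (q x) - Real.log (f x)) ∂(ofDensity ν q) := by
  have := hf.isProbabilityMeasure
  have := hq.isProbabilityMeasure
  rw [toReal_klDiv_of_measure_eq (ofDensity_absolutelyContinuous_ofDensity hf.measurable hf.pos)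
    (by simp), integral_congr_ae (llr_ae_eq hq hf)]

/-- A density `p` with `E_Q[f / p] ≤ 1` on the family, whose divergence from `Q` is at least the
infimum over the convex hull, is a reverse information projection. -/
theorem isRIPr_of_lintegral_div_le_one (hq : IsPosDensity ν q) (hp : IsPosDensity ν p)
    (h𝓕 : ∀ f ∈ 𝓕, IsPosDensity ν f)
    (hle : ∀ f ∈ 𝓕, ∫⁻ x, ENNReal.ofReal (f x / p x) ∂(ofDensity ν q) ≤ 1)
    (hint : Integrable (fun x => Real.log (q x) - Real.log (p x)) (ofDensity ν q))
    (hinf : ⨅ g ∈ convexHull ℝ 𝓕, klDiv (ofDensity ν q) (ofDensity ν g) ≤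
      klDiv (ofDensity ν q) (ofDensity ν p)) :
    IsRIPr ν q 𝓕 p := by
  have := hq.isProbabilityMeasure
  have hptop : klDiv (ofDensity ν q) (ofDensity ν p) ≠ ∞ := by
    rw [klDiv_ofDensity hq hp hint]; exact ENNReal.ofReal_ne_top
  have hpos : ∀ {f}, IsPosDensity ν f → ∀ x, 0 < f x / p x := fun hf x =>
    div_pos (hf.pos x) (hp.pos x)
  have hlog : ∀ {f}, IsPosDensity ν f → ∀ x, Real.log (f x / p x) =
      (Real.log (q x) - Real.log (p x)) - (Real.log (q x) - Real.log (f x)) := fun hf x => by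
    rw [Real.log_div (hf.pos x).ne' (hp.pos x).ne']; ring
  -- E_Q[f/p] ≤ 1 gives E_Q[log(f/p)] ≤ 0, so no f in the hull has smaller divergence than p.
  have hinf' : ⨅ g ∈ convexHull ℝ 𝓕, klDiv (ofDensity ν q) (ofDensity ν g) =
      klDiv (ofDensity ν q) (ofDensity ν p) := by
    refine le_antisymm hinf (le_iInf₂ fun f hf => ?_)
    have hfd := isPosDensity_of_mem_convexHull h𝓕 hf
    by_cases htop : klDiv (ofDensity ν q) (ofDensity ν f) = ∞
    · rw [htop]; exact le_top
    have hfi := integrable_of_klDiv_ne_top hq hfd htop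
    rw [klDiv_ofDensity hq hp hint, klDiv_ofDensity hq hfd hfi]
    refine ENNReal.ofReal_le_ofReal ?_
    have h1 := integral_log_nonpos (hfd.measurable.div hp.measurable) (hpos hfd)
      (lintegral_div_le_one_of_mem_convexHull h𝓕 hp hle hf)
      ((hint.sub hfi).congr (ae_of_all _ fun x => (hlog hfd x).symm))
    simp only [Pi.div_apply, hlog hfd] at h1
    rw [integral_sub hint hfi] at h1
    linarith
  refine ⟨hp.measurable, fun x => (hp.pos x).le, ae_of_all _ hp.pos, hp.lintegral_eq_one.le, ?_⟩
  intro f hf hlim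
  rw [hinf'] at hlim
  have hfd := fun j => isPosDensity_of_mem_convexHull h𝓕 (hf j)
  have hfin : ∀ᶠ j in atTop, klDiv (ofDensity ν q) (ofDensity ν (f j)) ≠ ∞ :=
    (hlim.eventually (gt_mem_nhds (lt_top_iff_ne_top.2 hptop))).mono fun j hj => hj.ne
  have hlim' := (ENNReal.tendsto_toReal hptop).comp hlim
  rw [ENNReal.tendsto_nhds_zero]
  intro δ hδ
  by_cases hδtop : δ = ∞
  · simp [hδtop]
  set η := δ.toReal with hη
  have hηpos : 0 < η := ENNReal.toReal_pos hδ.ne' hδtop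
  -- The margin is such that (1 + ε⁻¹) times the divergence gap is at most η/2 for ε = η/2; the
  -- bound on E|log(f_j/p)| then totals η.
  have hev : ∀ᶠ j in atTop, (klDiv (ofDensity ν q) (ofDensity ν (f j))).toReal <
      (klDiv (ofDensity ν q) (ofDensity ν p)).toReal + (1 + (η / 2)⁻¹)⁻¹ * (η / 2) :=
    hlim'.eventually (gt_mem_nhds (lt_add_of_pos_right _ (by positivity)))
  filter_upwards [hfin, hev] with j hj1 hj2
  have hfi := integrable_of_klDiv_ne_top hq (hfd j) hj1
  have hli := (hint.sub hfi).congr (ae_of_all _ fun x => (hlog (hfd j) x).symm)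
  have hb := integral_abs_log_le ((hfd j).measurable.div hp.measurable) (hpos (hfd j))
    (lintegral_div_le_one_of_mem_convexHull h𝓕 hp hle (hf j)) hli (half_pos hηpos)
  rw [toReal_klDiv_ofDensity hq (hfd j), toReal_klDiv_ofDensity hq hp] at hj2
  have he : ∀ x, ‖Real.log (f j x) - Real.log (p x)‖ₑ =
      ENNReal.ofReal |Real.log (f j x / p x)| := fun x => by
    rw [Real.log_div ((hfd j).pos x).ne' (hp.pos x).ne', Real.enorm_eq_ofReal_abs]
  simp_rw [he]
  rw [← ofReal_integral_eq_lintegral_ofReal hli.abs (ae_of_all _ fun x => abs_nonneg _)]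
  refine ENNReal.ofReal_le_of_le_toReal ?_
  have hs : ∫ x, Real.log (f j x / p x) ∂(ofDensity ν q) =
      ∫ x, (Real.log (q x) - Real.log (p x)) ∂(ofDensity ν q) -
        ∫ x, (Real.log (q x) - Real.log (f j x)) ∂(ofDensity ν q) := by
    rw [← integral_sub hint hfi]
    exact integral_congr_ae (ae_of_all _ fun x => hlog (hfd j) x)
  simp only [Pi.div_apply] at hb
  rw [hs] at hb
  have hK : 0 < 1 + (η / 2)⁻¹ := by positivity
  have : (1 + (η / 2)⁻¹) * (∫ x, (Real.log (q x) - Real.log (f j x)) ∂(ofDensity ν q) -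
      ∫ x, (Real.log (q x) - Real.log (p x)) ∂(ofDensity ν q)) ≤ η / 2 := by
    rw [← le_div_iff₀' hK, div_eq_inv_mul]
    linarith
  linarith

end RIPr

end GaussTest

/-! ### Approximating continuous mixtures by finite ones. -/

namespace GaussTest

section Mixture

variable {E : Type*} [MeasurableSpace E] {W : Measure E}

lemma integral_comp_simpleFunc [IsProbabilityMeasure W] (T : SimpleFunc E E) (F : E → ℝ) :
    ∫ m, F (T m) ∂W = ∑ y ∈ T.range, W.real (T ⁻¹' {y}) * F y := by
  have h : ∀ m, F (T m) = ∑ y ∈ T.range, (T ⁻¹' {y}).indicator (fun _ => F y) m := by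
    intro m
    rw [Finset.sum_eq_single (T m)]
    · simp
    · intro y _ hy
      exact Set.indicator_of_notMem (by simpa using hy.symm) _
    · intro hm
      exact absurd (T.mem_range_self m) hm
  simp_rw [h]
  rw [integral_finsetSum _ fun y _ =>
    (integrable_const _).indicator (T.measurableSet_fiber y)]
  refine Finset.sum_congr rfl fun y _ => ?_
  rw [integral_indicator_const _ (T.measurableSet_fiber y), smul_eq_mul]

/-- Under a simple function the prior becomes finitely supported, with weights W(T⁻¹{y}). -/
lemma integral_comp_simpleFunc_mem_convexHull {α : Type*} [IsProbabilityMeasure W]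
    (T : SimpleFunc E E) (P : E → α → ℝ) :
    (fun x => ∫ m, P (T m) x ∂W) ∈ convexHull ℝ (Set.range P) := by
  have h : (fun x => ∫ m, P (T m) x ∂W) = ∑ y ∈ T.range, W.real (T ⁻¹' {y}) • P y := by
    ext x
    rw [integral_comp_simpleFunc T fun m => P m x]
    simp
  rw [h]
  refine (convex_convexHull ℝ _).sum_mem (fun _ _ => measureReal_nonneg) ?_
    fun y _ => subset_convexHull ℝ _ ⟨y, rfl⟩
  have := integral_comp_simpleFunc (W := W) T fun _ => 1
  simpa using this.symm

end Mixture

section MixtureApprox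

variable {E : Type*} [NormedAddCommGroup E] [SecondCountableTopology E]
  [MeasurableSpace E] [BorelSpace E] {W : Measure E} [IsProbabilityMeasure W]

variable {α : Type*} [MeasurableSpace α] {ν : Measure α} [SFinite ν] {p q : α → ℝ}
  {P : E → α → ℝ}

/-- A continuous mixture of densities is approximated in Kullback-Leibler divergence by finite
mixtures. -/
theorem iInf_klDiv_le_mixture (hq : IsPosDensity ν q) (hp : IsPosDensity ν p)
    (hP : ∀ m, IsPosDensity ν (P m)) (hcont : ∀ x, Continuous fun m => P m x)
    {K : ℝ} (hK : ∀ m x, P m x ≤ K) (hpP : p =ᵐ[ν] fun x => ∫ m, P m x ∂W)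
    (hG : ∀ R : ℝ, ∃ G : α → ℝ, Integrable G (ofDensity ν q) ∧
      ∀ m, ‖m‖ ≤ R → ∀ x, Real.exp (-G x) ≤ P m x)
    (hlogq : Integrable (fun x => Real.log (q x)) (ofDensity ν q))
    (hlogp : Integrable (fun x => Real.log (p x)) (ofDensity ν q)) :
    ⨅ g ∈ convexHull ℝ (Set.range P), klDiv (ofDensity ν q) (ofDensity ν g) ≤
      klDiv (ofDensity ν q) (ofDensity ν p) := by
  have := hq.isProbabilityMeasure
  -- A ball of positive prior mass bounds all the approximating mixtures from below at once.
  obtain ⟨R, hR⟩ : ∃ R : ℕ, 0 < W (Metric.closedBall 0 R) := by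
    by_contra! hc
    have : W (⋃ R : ℕ, Metric.closedBall 0 R) = 0 :=
      measure_iUnion_null fun R => le_antisymm (hc R) (by simp)
    rw [Metric.iUnion_closedBall_nat, measure_univ] at this
    exact one_ne_zero this
  have hc : 0 < W.real (Metric.closedBall 0 R) :=
    ENNReal.toReal_pos hR.ne' (measure_ne_top _ _)
  set c := W.real (Metric.closedBall 0 R) with hcdef
  let T : ℕ → SimpleFunc E E := fun j =>
    SimpleFunc.approxOn id measurable_id Set.univ 0 (Set.mem_univ _) j
  have hT : ∀ m, Tendsto (fun j => T j m) atTop (𝓝 m) := fun m =>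
    SimpleFunc.tendsto_approxOn measurable_id (Set.mem_univ _) (by simp)
  have hTn : ∀ j m, ‖T j m‖ ≤ ‖m‖ + ‖m‖ := fun j m =>
    SimpleFunc.norm_approxOn_zero_le measurable_id (Set.mem_univ _) m j
  let f : ℕ → α → ℝ := fun j x => ∫ m, P (T j m) x ∂W
  have hfmem : ∀ j, f j ∈ convexHull ℝ (Set.range P) := fun j =>
    integral_comp_simpleFunc_mem_convexHull (T j) P
  have hfd : ∀ j, IsPosDensity ν (f j) := fun j =>
    isPosDensity_of_mem_convexHull (by rintro _ ⟨m, rfl⟩; exact hP m) (hfmem j)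
  have hmeasT : ∀ j x, AEStronglyMeasurable (fun m => P (T j m) x) W := fun j x =>
    ((hcont x).measurable.comp (T j).measurable).aestronglyMeasurable
  have hintT : ∀ j x, Integrable (fun m => P (T j m) x) W := fun j x =>
    Integrable.of_bound (hmeasT j x) K (ae_of_all _ fun m => by
      rw [Real.norm_of_nonneg ((hP _).pos x).le]; exact hK _ _)
  have hflim : ∀ x, Tendsto (fun j => f j x) atTop (𝓝 (∫ m, P m x ∂W)) := fun x =>
    tendsto_integral_of_dominated_convergence (fun _ => K) (fun j => hmeasT j x)
      (integrable_const _) (fun j => ae_of_all _ fun m => by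
        rw [Real.norm_of_nonneg ((hP _).pos x).le]; exact hK _ _)
      (ae_of_all _ fun m => ((hcont x).tendsto m).comp (hT m))
  have hfK : ∀ j x, f j x ≤ K := fun j x => by
    calc f j x ≤ ∫ _, K ∂W := integral_mono (hintT j x) (integrable_const _) fun m => hK _ _
      _ = K := by simp
  -- The radius doubles because the simple approximations satisfy only ‖T j m‖ ≤ 2‖m‖.
  obtain ⟨G, hGi, hGle⟩ := hG (R + R)
  have hflow : ∀ j x, c * Real.exp (-G x) ≤ f j x := fun j x => by
    calc c * Real.exp (-G x) = ∫ _ in Metric.closedBall 0 R, Real.exp (-G x) ∂W := by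
          simp [hcdef]
      _ ≤ ∫ m in Metric.closedBall 0 R, P (T j m) x ∂W := by
          refine setIntegral_mono_on (integrable_const _).integrableOn (hintT j x).integrableOn
            measurableSet_closedBall fun m hm => hGle _ ?_ x
          have := mem_closedBall_zero_iff.1 hm
          exact (hTn j m).trans (by linarith)
      _ ≤ f j x := setIntegral_le_integral (hintT j x)
          (ae_of_all _ fun m => ((hP _).pos x).le)
  -- The bounds c e^{-G} ≤ f_j ≤ K give a Q-integrable majorant of |log f_j| independent of j, as
  -- dominated convergence requires.
  have hbound : ∀ j x, ‖Real.log (f j x)‖ ≤ |Real.log K| + |Real.log c| + |G x| := fun j x => by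
    have h1 : Real.log (f j x) ≤ Real.log K := Real.log_le_log ((hfd j).pos x) (hfK j x)
    have h2 : Real.log c - G x ≤ Real.log (f j x) := by
      have := Real.log_le_log (mul_pos hc (Real.exp_pos _)) (hflow j x)
      rwa [Real.log_mul hc.ne' (Real.exp_ne_zero _), Real.log_exp] at this
    rw [Real.norm_eq_abs, abs_le]
    have := le_abs_self (Real.log K)
    have := neg_abs_le (Real.log c)
    have := le_abs_self (G x)
    have := abs_nonneg (Real.log K)
    have := abs_nonneg (Real.log c)
    have := abs_nonneg (G x)
    constructor <;> linarith
  have hbi : Integrable (fun x => |Real.log K| + |Real.log c| + |G x|) (ofDensity ν q) :=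
    (integrable_const _).add hGi.abs
  have hlogm : ∀ j, AEStronglyMeasurable (fun x => Real.log (f j x)) (ofDensity ν q) := fun j =>
    (Real.measurable_log.comp (hfd j).measurable).aestronglyMeasurable
  have hlogi : ∀ j, Integrable (fun x => Real.log (f j x)) (ofDensity ν q) := fun j =>
    hbi.mono' (hlogm j) (ae_of_all _ (hbound j))
  have hlim : Tendsto (fun j => ∫ x, Real.log (f j x) ∂(ofDensity ν q)) atTop
      (𝓝 (∫ x, Real.log (p x) ∂(ofDensity ν q))) := by
    refine tendsto_integral_of_dominated_convergence _ hlogm hbi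
      (fun j => ae_of_all _ (hbound j)) ?_
    filter_upwards [ofDensity_absolutelyContinuous.ae_le hpP] with x hx
    rw [hx]
    exact (hflim x).log (by rw [← hx]; exact (hp.pos x).ne')
  have hkl : Tendsto (fun j => klDiv (ofDensity ν q) (ofDensity ν (f j))) atTop
      (𝓝 (klDiv (ofDensity ν q) (ofDensity ν p))) := by
    rw [klDiv_ofDensity hq hp (hlogq.sub hlogp), integral_sub hlogq hlogp]
    have h : ∀ j, klDiv (ofDensity ν q) (ofDensity ν (f j)) = ENNReal.ofReal
        (∫ x, Real.log (q x) ∂(ofDensity ν q) - ∫ x, Real.log (f j x) ∂(ofDensity ν q)) :=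
      fun j => by
        rw [klDiv_ofDensity hq (hfd j) (hlogq.sub (hlogi j)), integral_sub hlogq (hlogi j)]
    simp_rw [h]
    exact ENNReal.tendsto_ofReal (hlim.const_sub _)
  exact ge_of_tendsto' hkl fun j => iInf₂_le (f j) (hfmem j)

end MixtureApprox

end GaussTest

/-! ### Projections of a single Gaussian outcome and the sequential statistic. -/

namespace GaussTest

variable {d n : ℕ} {S T C Sp Sq : Matrix (Fin d) (Fin d) ℝ}

lemma isPosDensity_gaussDensity (hS : S.PosDef) (m : Obs d) :
    IsPosDensity volume (gaussDensity S m) :=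
  isPosDensity_of_isProbabilityMeasure (measurable_gaussDensity m) (gaussDensity_pos hS m)
    (by rw [← multivariateGaussian_eq_ofDensity hS]; infer_instance)

lemma isPosDensity_iidDensity (hS : S.PosDef) (m : Obs d) :
    IsPosDensity volume fun u : Sample d n => iidDensity S m u :=
  isPosDensity_of_isProbabilityMeasure (measurable_iidDensity m) (iidDensity_pos hS m)
    (by rw [← iidLaw_eq_ofDensity hS]; infer_instance)

lemma isPosDensity_of_mem_nullDensities₁ (hS : S.PosDef) :
    ∀ f ∈ nullDensities₁ S, IsPosDensity volume f := by
  rintro _ ⟨m, rfl⟩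
  exact isPosDensity_gaussDensity hS m

lemma isPosDensity_of_mem_nullDensities (hS : S.PosDef) :
    ∀ f ∈ nullDensities S n, IsPosDensity volume f := by
  rintro _ ⟨m, rfl⟩
  exact isPosDensity_iidDensity hS m

lemma gaussDensity_le (hS : S.PosDef) (m x : Obs d) :
    gaussDensity S m x ≤ Real.exp (logNorm S) := by
  rw [gaussDensity_eq_exp hS]
  refine Real.exp_le_exp.2 ?_
  have := quadForm_nonneg hS.inv.posSemidef (x - m)
  linarith

lemma iidDensity_le (hS : S.PosDef) (m : Obs d) (u : Sample d n) :
    iidDensity S m u ≤ Real.exp (logNorm S) ^ n := by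
  have := Finset.prod_le_prod (s := Finset.univ) (fun i _ => (gaussDensity_pos hS m (u i)).le)
    fun i _ => gaussDensity_le hS m (u i)
  simpa [iidDensity] using this

lemma continuous_iidDensity_left (u : Sample d n) : Continuous fun m => iidDensity S m u := by
  unfold iidDensity
  exact continuous_finsetProd _ fun i _ => continuous_gaussDensity_left (u i)

/-- Nonnegativity of the form at x + m bounds it at x - m by twice its values at x and at m, and the
latter is bounded on balls. This supplies the lower envelope for the mixture approximation. -/
lemma exists_exp_neg_quadForm_le (hS : S.PosDef) (R : ℝ) :
    ∃ B : ℝ, ∀ m : Obs d, ‖m‖ ≤ R → ∀ x,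
      Real.exp (-(quadForm S⁻¹ x + B)) ≤ gaussDensity S m x := by
  obtain ⟨B, hB⟩ := (isCompact_closedBall (0 : Obs d) R).exists_bound_of_continuousOn
    (continuous_quadForm S⁻¹).continuousOn
  refine ⟨B - logNorm S, fun m hm x => ?_⟩
  rw [gaussDensity_eq_exp hS]
  refine Real.exp_le_exp.2 ?_
  have h1 := (le_abs_self _).trans (hB m (mem_closedBall_zero_iff.2 hm))
  have h2 := quadForm_nonneg hS.inv.posSemidef (x + m)
  rw [quadForm_add hS.inv.isHermitian] at h2
  rw [quadForm_sub hS.inv.isHermitian]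
  linarith

/-! ### Local projections -/

/-- The ratio of two null densities with equal covariance is the exponential of an affine function;
tilting N(m, Sq) by it only shifts the mean and leaves a constant governed by Sp - Sq. -/
lemma gaussDensity_div_mul (hSp : Sp.PosDef) (hSq : Sq.PosDef) (m m' x : Obs d) :
    gaussDensity Sp m' x / gaussDensity Sp m x * gaussDensity Sq m x =
      Real.exp (-(1 / 2) * quadForm (Sp - Sq) (WithLp.toLp 2 (Sp⁻¹ *ᵥ (m' - m).ofLp))) *
        gaussDensity Sq (m + WithLp.toLp 2 (Sq *ᵥ (Sp⁻¹ *ᵥ (m' - m).ofLp))) x := by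
  set t : Fin d → ℝ := Sp⁻¹ *ᵥ (m' - m).ofLp with ht
  have hδ : (m' - m).ofLp = Sp *ᵥ t := by
    rw [ht, Matrix.mulVec_mulVec, Matrix.mul_nonsing_inv _
      (isUnit_iff_ne_zero.2 hSp.det_pos.ne'), Matrix.one_mulVec]
  have e1 : x - m' = (x - m) - (m' - m) := by abel
  have e2 : ∀ v : Obs d, x - (m + v) = (x - m) - v := fun v => by abel
  have h1 : quadForm Sp⁻¹ (m' - m) = t ⬝ᵥ (Sp *ᵥ t) := by
    rw [quadForm, ← ht, hδ, dotProduct_comm]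
  have h2 : Sq⁻¹ *ᵥ (Sq *ᵥ t) = t := by
    rw [Matrix.mulVec_mulVec, Matrix.nonsing_inv_mul _
      (isUnit_iff_ne_zero.2 hSq.det_pos.ne'), Matrix.one_mulVec]
  rw [gaussDensity_eq_exp hSp, gaussDensity_eq_exp hSp, gaussDensity_eq_exp hSq,
    gaussDensity_eq_exp hSq, ← Real.exp_sub, ← Real.exp_add, ← Real.exp_add, e1, e2,
    quadForm_sub hSp.inv.isHermitian (x - m) (m' - m),
    quadForm_sub hSq.inv.isHermitian (x - m) (WithLp.toLp 2 (Sq *ᵥ t)), h1, ← ht]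
  congr 1
  simp only [quadForm, h2, Matrix.sub_mulVec, dotProduct_sub, dotProduct_comm (Sq *ᵥ t) t]
  ring

/-- After the tilt, E_Q[p_{m'}/p_m] is that constant, at most 1 because Sp - Sq is positive
semidefinite. The candidate lies in the family, so the infimum condition is immediate. -/
theorem isRIPr_gaussDensity_of_simple (hSp : Sp.PosDef) (hSq : Sq.PosDef)
    (h : (Sp - Sq).PosSemidef) (m : Obs d) :
    IsRIPr volume (gaussDensity Sq m) (nullDensities₁ Sp) (gaussDensity Sp m) := by
  refine isRIPr_of_lintegral_div_le_one (isPosDensity_gaussDensity hSq m)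
    (isPosDensity_gaussDensity hSp m) (isPosDensity_of_mem_nullDensities₁ hSp) ?_ ?_ ?_
  · rintro _ ⟨m', rfl⟩
    have hm : Measurable fun x => ENNReal.ofReal (gaussDensity Sp m' x / gaussDensity Sp m x) :=
      ((measurable_gaussDensity m').div (measurable_gaussDensity m)).ennreal_ofReal
    rw [lintegral_ofDensity (measurable_gaussDensity m) hm]
    have e : ∀ x, ENNReal.ofReal (gaussDensity Sq m x) *
        ENNReal.ofReal (gaussDensity Sp m' x / gaussDensity Sp m x) =
        ENNReal.ofReal (Real.exp (-(1 / 2) *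
          quadForm (Sp - Sq) (WithLp.toLp 2 (Sp⁻¹ *ᵥ (m' - m).ofLp)))) *
        ENNReal.ofReal (gaussDensity Sq
          (m + WithLp.toLp 2 (Sq *ᵥ (Sp⁻¹ *ᵥ (m' - m).ofLp))) x) := fun x => by
      rw [← ENNReal.ofReal_mul (gaussDensity_nonneg _ _), mul_comm (gaussDensity Sq m x),
        gaussDensity_div_mul hSp hSq, ENNReal.ofReal_mul (Real.exp_pos _).le]
    simp_rw [e]
    rw [lintegral_const_mul _ (measurable_gaussDensity _).ennreal_ofReal,
      (isPosDensity_gaussDensity hSq _).lintegral_eq_one, mul_one]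
    refine ENNReal.ofReal_le_one.2 (Real.exp_le_one_iff.2 ?_)
    have := quadForm_nonneg h (WithLp.toLp 2 (Sp⁻¹ *ᵥ (m' - m).ofLp))
    linarith
  · rw [← multivariateGaussian_eq_ofDensity hSq]
    exact (integrable_log_gaussDensity hSq m m).sub (integrable_log_gaussDensity hSp m m)
  · exact iInf₂_le (gaussDensity Sp m) (subset_convexHull ℝ (nullDensities₁ Sp) ⟨m, rfl⟩)

lemma lintegral_div_self_le_one {α : Type*} [MeasurableSpace α] {ν : Measure α} {f q : α → ℝ}
    (hq : IsPosDensity ν q) (hf : IsPosDensity ν f) :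
    ∫⁻ x, ENNReal.ofReal (f x / q x) ∂(ofDensity ν q) ≤ 1 := by
  have hm : Measurable fun x => ENNReal.ofReal (f x / q x) :=
    (hf.measurable.div hq.measurable).ennreal_ofReal
  rw [lintegral_ofDensity hq.measurable hm, ← hf.lintegral_eq_one]
  refine (lintegral_congr fun x => ?_).le
  rw [← ENNReal.ofReal_mul (hq.pos x).le, mul_div_cancel₀ _ (hq.pos x).ne']

/-- N(m, Sq) is the mixture of null elements under the possibly degenerate prior N(m, Sq - Sp), so
the hull comes arbitrarily close to it in divergence; also E_Q[f/q] = ∫ f = 1. -/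
theorem isRIPr_gaussDensity_of_antisimple (hSp : Sp.PosDef) (hSq : Sq.PosDef)
    (h : (Sq - Sp).PosSemidef) (m : Obs d) :
    IsRIPr volume (gaussDensity Sq m) (nullDensities₁ Sp) (gaussDensity Sq m) := by
  have hq := isPosDensity_gaussDensity hSq m
  have hlog : Integrable (fun x => Real.log (gaussDensity Sq m x))
      (ofDensity volume (gaussDensity Sq m)) := by
    rw [← multivariateGaussian_eq_ofDensity hSq]
    exact integrable_log_gaussDensity hSq m m
  refine isRIPr_of_lintegral_div_le_one hq hq (isPosDensity_of_mem_nullDensities₁ hSp)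
    (fun f hf => lintegral_div_self_le_one hq (isPosDensity_of_mem_nullDensities₁ hSp f hf))
    (hlog.sub hlog) ?_
  refine iInf_klDiv_le_mixture (W := multivariateGaussian m (Sq - Sp)) hq hq
    (isPosDensity_gaussDensity hSp) continuous_gaussDensity_left (gaussDensity_le hSp) ?_ ?_
    hlog hlog
  · have := integral_gaussDensity_multivariateGaussian hSp h m
    rw [add_sub_cancel] at this
    exact this.symm
  · intro R
    obtain ⟨B, hB⟩ := exists_exp_neg_quadForm_le hSp R
    refine ⟨fun x => quadForm Sp⁻¹ x + B, ?_, hB⟩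
    rw [← multivariateGaussian_eq_ofDensity hSq]
    have := integrable_quadForm_sub (S := Sq) Sp⁻¹ m 0
    simp only [sub_zero] at this
    exact this.add (integrable_const B)

lemma measurable_gaussDensity_plugIn {k : ℕ} (n₀ : ℝ) (x₀ : Obs d) :
    Measurable fun z : Sample d k × Obs d => gaussDensity S (plugIn n₀ x₀ z.1) z.2 := by
  unfold gaussDensity plugIn
  simp only [dotProduct, Matrix.mulVec]
  fun_prop

theorem isSeqRIPr_of_simple (hSp : Sp.PosDef) (hSq : Sq.PosDef)
    (h : (Sp - Sq).PosSemidef) (n₀ : ℝ) (x₀ : Obs d) :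
    IsSeqRIPr Sp Sq n₀ x₀ fun _ past => gaussDensity Sp (plugIn n₀ x₀ past) := fun _ =>
  ⟨measurable_gaussDensity_plugIn n₀ x₀, fun _ => isRIPr_gaussDensity_of_simple hSp hSq h _⟩

theorem isSeqRIPr_of_antisimple (hSp : Sp.PosDef) (hSq : Sq.PosDef)
    (h : (Sq - Sp).PosSemidef) (n₀ : ℝ) (x₀ : Obs d) :
    IsSeqRIPr Sp Sq n₀ x₀ fun _ past => gaussDensity Sq (plugIn n₀ x₀ past) := fun _ =>
  ⟨measurable_gaussDensity_plugIn n₀ x₀, fun _ => isRIPr_gaussDensity_of_antisimple hSp hSq h _⟩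

lemma indepFun_pastOf_eval (m : Obs d) (i : Fin n) :
    IndepFun (fun u : Sample d n => pastOf u i) (fun u => u i) (iidLaw S m n) := by
  have h := iIndepFun_pi (μ := fun _ : Fin n => multivariateGaussian m S)
    (X := fun _ x => x) (fun _ => aemeasurable_id)
  have h2 := h.indepFun_finset (Finset.Iio i) {i} (by simp) (fun _ => measurable_pi_apply _)
  exact h2.comp
    (φ := fun (v : Finset.Iio i → Obs d) (j : Fin i) =>
      v ⟨j.castLE i.isLt.le, by simpa using Fin.lt_def.2 j.isLt⟩)
    (ψ := fun (v : ({i} : Finset (Fin n)) → Obs d) => v ⟨i, by simp⟩)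
    (by fun_prop) (by fun_prop)

/-- For each past, the versions agree almost surely under the plug-in predictive law, hence under
the true law of the next outcome, both being equivalent to Lebesgue measure. Independence and joint
measurability let Fubini combine the pasts. -/
lemma IsSeqRIPr.ae_eq (hSp : Sp.PosDef) (hSq : Sq.PosDef) {n₀ : ℝ} {x₀ : Obs d}
    {p p' : (k : ℕ) → Sample d k → Obs d → ℝ} (hp : IsSeqRIPr Sp Sq n₀ x₀ p)
    (hp' : IsSeqRIPr Sp Sq n₀ x₀ p') (m : Obs d) (n : ℕ) :
    ∀ᵐ u ∂(iidLaw Sq m n), ∀ i : Fin n, p i (pastOf u i) (u i) = p' i (pastOf u i) (u i) := by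
  rw [ae_all_iff]
  intro i
  have hpast : Measurable fun u : Sample d n => pastOf u i := by
    unfold pastOf; fun_prop
  have heval : Measurable fun u : Sample d n => u i := measurable_pi_apply i
  have hmap := (indepFun_iff_map_prod_eq_prod_map_map hpast.aemeasurable heval.aemeasurable).1
    (indepFun_pastOf_eval (S := Sq) m i)
  have hlaw : (iidLaw Sq m n).map (fun u => u i) = multivariateGaussian m Sq :=
    (measurePreserving_eval (fun _ : Fin n => multivariateGaussian m Sq) i).map_eq
  rw [hlaw] at hmap
  have hms : MeasurableSet {z : Sample d i × Obs d | p i z.1 z.2 = p' i z.1 z.2} :=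
    measurableSet_eq_fun (hp i).1 (hp' i).1
  have hsec : ∀ past : Sample d i, ∀ᵐ x ∂(multivariateGaussian m Sq), p i past x = p' i past x := by
    intro past
    have h1 := ((hp i).2 past).ae_eq (isPosDensity_of_mem_nullDensities₁ hSp)
      (Set.range_nonempty _) ((hp' i).2 past)
    have h2 := (absolutelyContinuous_ofDensity (ν := volume) (measurable_gaussDensity _)
      (gaussDensity_pos hSq (plugIn n₀ x₀ past))).ae_le h1
    rw [multivariateGaussian_eq_ofDensity hSq]
    exact ofDensity_absolutelyContinuous.ae_le h2
  have hae : ∀ᵐ z ∂((iidLaw Sq m n).map (fun u => (pastOf u i, u i))),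
      p i z.1 z.2 = p' i z.1 z.2 := by
    rw [hmap, Measure.ae_prod_iff_ae_ae hms]
    exact ae_of_all _ hsec
  exact ae_of_ae_map (hpast.prodMk heval).aemeasurable hae

/-- The numerators cancel, leaving the maximized null likelihood over the null's own plug-in
likelihood. The data have covariance Sq, not Sp, hence tr(Sq Sp⁻¹) in place of d. -/
theorem seqRIP_simple_asymptotics (hSp : Sp.PosDef) (hSq : Sq.PosDef) (h : (Sp - Sq).PosSemidef)
    (m : Obs d) {n₀ : ℝ} (hn₀ : 0 < n₀) (x₀ : Obs d) (p : (k : ℕ) → Sample d k → Obs d → ℝ)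
    (hp : IsSeqRIPr Sp Sq n₀ x₀ p) :
    (∀ n : ℕ, 1 ≤ n → Integrable (fun u => Real.log (seqRIP Sq n₀ x₀ p u /
        plugInUI Sp Sq n₀ x₀ u)) (iidLaw Sq m n)) ∧
      (fun n : ℕ => (∫ u, Real.log (seqRIP Sq n₀ x₀ p u /
        plugInUI Sp Sq n₀ x₀ u) ∂(iidLaw Sq m n)) - effDim Sq Sp / 2 * Real.log n)
        =O[atTop] (fun _ => (1 : ℝ)) := by
  have hae : ∀ n : ℕ, 1 ≤ n → (fun u => Real.log (seqRIP Sq n₀ x₀ p u /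
      plugInUI Sp Sq n₀ x₀ u)) =ᵐ[iidLaw Sq m n] fun u => Real.log (condFactor Sp u) + logNorm Sp -
        Real.log (plugInDensity Sp n₀ x₀ u) := by
    intro n hn
    filter_upwards [hp.ae_eq hSp hSq (isSeqRIPr_of_simple hSp hSq h n₀ x₀) m n] with u hu
    have h1 := (condFactor_pos hSp u).ne'
    have h2 := (plugInDensity_pos hSq n₀ x₀ u).ne'
    have h3 := (plugInDensity_pos hSp n₀ x₀ u).ne'
    have e1 : seqRIP Sq n₀ x₀ p u = plugInDensity Sq n₀ x₀ u / plugInDensity Sp n₀ x₀ u := by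
      simp only [seqRIP, hu, plugInDensity, Finset.prod_div_distrib]
    have e : seqRIP Sq n₀ x₀ p u / plugInUI Sp Sq n₀ x₀ u =
        condFactor Sp u * Real.exp (logNorm Sp) / plugInDensity Sp n₀ x₀ u := by
      rw [e1, plugInUI, maxLikelihood_eq hSp hn]
      field_simp
    rw [e, Real.log_div (mul_ne_zero h1 (Real.exp_ne_zero _)) h3,
      Real.log_mul h1 (Real.exp_ne_zero _), Real.log_exp]
  refine ⟨fun n hn => (integrable_condFactor_sub_plugIn hSp hSq hn hn₀ x₀ m _).congr
    (hae n hn).symm, ?_⟩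
  refine (isBigO_integral_condFactor_sub_plugIn hSp hSq hn₀ x₀ m (logNorm Sp)).congr' ?_
    EventuallyEq.rfl
  filter_upwards [eventually_ge_atTop 1] with n hn
  rw [integral_congr_ae (hae n hn)]

theorem log_seqRIP_ae_eq_zero_of_antisimple (hSp : Sp.PosDef) (hSq : Sq.PosDef)
    (h : (Sq - Sp).PosSemidef) (m : Obs d) {n₀ : ℝ} {x₀ : Obs d}
    {p : (k : ℕ) → Sample d k → Obs d → ℝ} (hp : IsSeqRIPr Sp Sq n₀ x₀ p) (n : ℕ) :
    (fun u => Real.log (seqRIP Sq n₀ x₀ p u)) =ᵐ[iidLaw Sq m n] 0 := by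
  filter_upwards [hp.ae_eq hSp hSq (isSeqRIPr_of_antisimple hSp hSq h n₀ x₀) m n] with u hu
  have e1 : seqRIP Sq n₀ x₀ p u = 1 := by
    simp only [seqRIP, hu]
    exact Finset.prod_eq_one fun i _ => div_self (gaussDensity_pos hSq _ _).ne'
  simp [e1]

end GaussTest

/-! ### The projection of the Bayes marginal in the anti-simple case. -/

namespace GaussTest

variable {d n : ℕ} {S T C D Sp Sq : Matrix (Fin d) (Fin d) ℝ}

/-- Lets the Bayes marginal be replaced by its factorized version, which is visibly measurable and
positive everywhere. -/
lemma IsRIPr.congr_left {α : Type*} [MeasurableSpace α] {ν : Measure α} {p q q' : α → ℝ}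
    {𝓕 : Set (α → ℝ)} (h : IsRIPr ν q 𝓕 p) (hqq' : ofDensity ν q = ofDensity ν q') :
    IsRIPr ν q' 𝓕 p := by
  obtain ⟨h1, h2, h3, h4, h5⟩ := h
  rw [hqq'] at h3
  refine ⟨h1, h2, h3, h4, fun f hf hlim => ?_⟩
  rw [← hqq'] at hlim ⊢
  exact h5 f hf hlim

/-- The factorized form of the Bayes marginal density. -/
noncomputable def bayesFactored (S : Matrix (Fin d) (Fin d) ℝ) (m₁ : Obs d)
    (C : Matrix (Fin d) (Fin d) ℝ) (u : Sample d n) : ℝ :=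
  condFactor S u * gaussDensity (S + (n : ℝ) • C) (Real.sqrt n • m₁) (suffStat u)

lemma add_smul_posDef (hS : S.PosDef) (hC : C.PosSemidef) (n : ℕ) : (S + (n : ℝ) • C).PosDef :=
  hS.add_posSemidef (hC.smul (Nat.cast_nonneg n : (0 : ℝ) ≤ n))

lemma measurable_bayesFactored (m₁ : Obs d) :
    Measurable fun u : Sample d n => bayesFactored S m₁ C u :=
  measurable_condFactor.mul ((measurable_gaussDensity _).comp measurable_suffStat)

lemma bayesFactored_pos (hS : S.PosDef) (hC : C.PosSemidef) (m₁ : Obs d) (u : Sample d n) :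
    0 < bayesFactored S m₁ C u :=
  mul_pos (condFactor_pos hS u) (gaussDensity_pos (add_smul_posDef hS hC n) _ _)

lemma ofDensity_bayesDensity (hS : S.PosDef) (hC : C.PosSemidef) (hn : 1 ≤ n) (m₁ : Obs d) :
    ofDensity volume (fun u : Sample d n => bayesDensity S m₁ C u) =
      ofDensity volume fun u => bayesFactored S m₁ C u := by
  refine withDensity_congr_ae ?_
  filter_upwards [bayesDensity_ae_eq hS hC hn m₁] with u hu
  rw [hu, bayesFactored]

lemma measurable_iidDensity_uncurry :
    Measurable fun z : Sample d n × Obs d => iidDensity S z.2 z.1 := by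
  unfold iidDensity gaussDensity
  simp only [dotProduct, Matrix.mulVec]
  fun_prop

/-- The Bayes marginal is the mixture of the i.i.d. laws. -/
lemma lintegral_bayes (hS : S.PosDef) (hC : C.PosSemidef) (hn : 1 ≤ n) (m₁ : Obs d)
    {h : Sample d n → ℝ≥0∞} (hh : Measurable h) :
    ∫⁻ u, h u ∂(ofDensity volume fun u : Sample d n => bayesFactored S m₁ C u) =
      ∫⁻ m, ∫⁻ u, h u ∂(iidLaw S m n) ∂(multivariateGaussian m₁ C) := by
  rw [lintegral_ofDensity (measurable_bayesFactored m₁) hh]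
  have h1 : ∀ᵐ u : Sample d n, ENNReal.ofReal (bayesFactored S m₁ C u) * h u =
      ∫⁻ m, ENNReal.ofReal (iidDensity S m u) * h u ∂(multivariateGaussian m₁ C) := by
    filter_upwards [bayesDensity_ae_eq hS hC hn m₁] with u hu
    have hi : Integrable (fun m => iidDensity S m u) (multivariateGaussian m₁ C) :=
      Integrable.of_bound (continuous_iidDensity_left u).aestronglyMeasurable
        (Real.exp (logNorm S) ^ n) (ae_of_all _ fun m => by
          rw [Real.norm_of_nonneg (iidDensity_pos hS m u).le]; exact iidDensity_le hS m u)
    rw [lintegral_mul_const _ (continuous_iidDensity_left u).measurable.ennreal_ofReal,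
      ← ofReal_integral_eq_lintegral_ofReal hi (ae_of_all _ fun m => (iidDensity_pos hS m u).le)]
    change _ = ENNReal.ofReal (bayesDensity S m₁ C u) * h u
    rw [hu, bayesFactored]
  rw [lintegral_congr_ae h1, lintegral_lintegral_swap]
  · refine lintegral_congr fun m => ?_
    rw [iidLaw_eq_ofDensity hS, lintegral_ofDensity (measurable_iidDensity m) hh]
  · exact (measurable_iidDensity_uncurry.ennreal_ofReal.mul (hh.comp measurable_fst)).aemeasurable

lemma isPosDensity_bayesFactored (hS : S.PosDef) (hC : C.PosSemidef) (hn : 1 ≤ n) (m₁ : Obs d) :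
    IsPosDensity volume fun u : Sample d n => bayesFactored S m₁ C u := by
  refine isPosDensity_of_isProbabilityMeasure (measurable_bayesFactored m₁)
    (bayesFactored_pos hS hC m₁) ⟨?_⟩
  have h := lintegral_bayes hS hC hn m₁ (h := fun _ => 1) measurable_const
  simpa using h

lemma map_eval_bayes (hS : S.PosDef) (hC : C.PosSemidef) (hn : 1 ≤ n) (m₁ : Obs d) (i : Fin n) :
    (ofDensity volume fun u : Sample d n => bayesFactored S m₁ C u).map (fun u => u i) =
      multivariateGaussian m₁ (S + C) := by
  refine Measure.ext_of_lintegral _ fun f hf => ?_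
  rw [lintegral_map hf (measurable_pi_apply i),
    lintegral_bayes hS hC hn m₁ (h := fun u : Sample d n => f (u i))
      (hf.comp (measurable_pi_apply i)),
    ← lintegral_multivariateGaussian_add hS.posSemidef hC m₁ hf]
  refine lintegral_congr fun m => ?_
  rw [← (measurePreserving_eval (fun _ : Fin n => multivariateGaussian m S) i).map_eq,
    lintegral_map hf (measurable_pi_apply i)]
  rfl

lemma map_suffStat_bayes (hS : S.PosDef) (hC : C.PosSemidef) (hn : 1 ≤ n) (m₁ : Obs d) :
    (ofDensity volume fun u : Sample d n => bayesFactored S m₁ C u).map suffStat =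
      multivariateGaussian (Real.sqrt n • m₁) (S + (n : ℝ) • C) := by
  have h1 := map_smul_multivariateGaussian hC m₁ (Real.sqrt n)
  rw [Real.sq_sqrt (Nat.cast_nonneg n)] at h1
  refine Measure.ext_of_lintegral _ fun f hf => ?_
  rw [lintegral_map hf measurable_suffStat,
    lintegral_bayes hS hC hn m₁ (h := fun u : Sample d n => f (suffStat u))
      (hf.comp measurable_suffStat),
    ← lintegral_multivariateGaussian_add hS.posSemidef
      (hC.smul (Nat.cast_nonneg n : (0 : ℝ) ≤ n)) _ hf, ← h1]
  have h2 : ∀ m : Obs d, ∫⁻ u, f (suffStat u) ∂(iidLaw S m n) =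
      ∫⁻ x, f x ∂(multivariateGaussian (Real.sqrt n • m) S) := fun m => by
    rw [← map_suffStat_iidLaw hS m hn, lintegral_map hf measurable_suffStat]
  have h3 : ∀ m : Obs d, ∫⁻ x, f x ∂(multivariateGaussian m S) =
      ∫⁻ x, f (m + x) ∂(multivariateGaussian 0 S) := fun m => by
    rw [← lintegral_map (g := fun x => m + x) hf (by fun_prop),
      map_const_add_multivariateGaussian, add_zero]
  rw [lintegral_map _ (by fun_prop)]
  · exact lintegral_congr h2
  · simp_rw [h3]
    exact Measurable.lintegral_prod_right (hf.comp (by fun_prop))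

lemma integrable_log_gaussDensity_eval_bayes (hS : S.PosDef) (hC : C.PosSemidef) (hn : 1 ≤ n)
    (m₁ : Obs d) (hT : T.PosDef) (w : Obs d) (i : Fin n) :
    Integrable (fun u : Sample d n => Real.log (gaussDensity T w (u i)))
      (ofDensity volume fun u : Sample d n => bayesFactored S m₁ C u) := by
  have h := integrable_log_gaussDensity (T := S + C) hT m₁ w
  rw [← map_eval_bayes hS hC hn m₁ i] at h
  exact (integrable_map_measure (measurable_log_gaussDensity w).aestronglyMeasurable
    (measurable_pi_apply i).aemeasurable).1 h

lemma integrable_log_gaussDensity_suffStat_bayes (hS : S.PosDef) (hC : C.PosSemidef) (hn : 1 ≤ n)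
    (m₁ : Obs d) (hT : T.PosDef) (w : Obs d) :
    Integrable (fun u : Sample d n => Real.log (gaussDensity T w (suffStat u)))
      (ofDensity volume fun u : Sample d n => bayesFactored S m₁ C u) := by
  have h := integrable_log_gaussDensity (T := S + (n : ℝ) • C) hT (Real.sqrt n • m₁) w
  rw [← map_suffStat_bayes hS hC hn m₁] at h
  exact (integrable_map_measure (measurable_log_gaussDensity w).aestronglyMeasurable
    measurable_suffStat.aemeasurable).1 h

lemma integrable_log_bayesFactored (hS : S.PosDef) (hC : C.PosSemidef) (hn : 1 ≤ n)
    (m₁ : Obs d) (hT : T.PosDef) (hD : D.PosSemidef) (w : Obs d) :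
    Integrable (fun u : Sample d n => Real.log (bayesFactored T w D u))
      (ofDensity volume fun u : Sample d n => bayesFactored S m₁ C u) := by
  have hTD := add_smul_posDef hT hD n
  have h : ∀ u : Sample d n, Real.log (bayesFactored T w D u) =
      (∑ i, Real.log (gaussDensity T 0 (u i)) - Real.log (gaussDensity T 0 (suffStat u))) +
        Real.log (gaussDensity (T + (n : ℝ) • D) (Real.sqrt n • w) (suffStat u)) := fun u => by
    rw [bayesFactored, Real.log_mul (condFactor_pos hT u).ne' (gaussDensity_pos hTD _ _).ne',
      condFactor, Real.log_div (iidDensity_pos hT _ _).ne' (gaussDensity_pos hT _ _).ne',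
      log_iidDensity hT]
  simp_rw [h]
  exact ((integrable_finsetSum _ fun i _ =>
    integrable_log_gaussDensity_eval_bayes hS hC hn m₁ hT 0 i).sub
    (integrable_log_gaussDensity_suffStat_bayes hS hC hn m₁ hT 0)).add
    (integrable_log_gaussDensity_suffStat_bayes hS hC hn m₁ hTD _)

/-- The integrand keeps the null law of Z but takes the conditional law given Z from the
alternative, so it is again a probability density. -/
lemma lintegral_iidDensity_mul_condFactor_div (hSp : Sp.PosDef) (hSq : Sq.PosDef) (hn : 1 ≤ n)
    (m : Obs d) :
    ∫⁻ u : Sample d n, ENNReal.ofReal (iidDensity Sp m u *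
      (condFactor Sq u / condFactor Sp u)) = 1 := by
  have hg : Measurable fun z => ENNReal.ofReal
      (gaussDensity Sp (Real.sqrt n • m) z / gaussDensity Sq (Real.sqrt n • 0) z) :=
    ((measurable_gaussDensity _).div (measurable_gaussDensity _)).ennreal_ofReal
  have h1 : ∀ u : Sample d n, ENNReal.ofReal (iidDensity Sp m u *
      (condFactor Sq u / condFactor Sp u)) = ENNReal.ofReal (iidDensity Sq 0 u) *
        ENNReal.ofReal (gaussDensity Sp (Real.sqrt n • m) (suffStat u) /
          gaussDensity Sq (Real.sqrt n • 0) (suffStat u)) := fun u => by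
    have h2 := (condFactor_pos hSp u).ne'
    have h3 := (gaussDensity_pos hSq (Real.sqrt n • 0) (suffStat u)).ne'
    rw [← ENNReal.ofReal_mul (iidDensity_pos hSq _ _).le, iidDensity_eq_condFactor_mul hSp hn,
      iidDensity_eq_condFactor_mul hSq hn]
    congr 1
    field_simp
  have h2 := lintegral_ofDensity (ν := volume) (measurable_iidDensity (S := Sq) (n := n) 0)
    (hg.comp measurable_suffStat)
  rw [lintegral_congr h1]
  refine h2.symm.trans ?_
  rw [← iidLaw_eq_ofDensity hSq]
  change ∫⁻ u, (fun z => ENNReal.ofReal (gaussDensity Sp (Real.sqrt n • m) z /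
    gaussDensity Sq (Real.sqrt n • 0) z)) (suffStat u) ∂_ = 1
  rw [← lintegral_map hg measurable_suffStat, map_suffStat_iidLaw hSq 0 hn,
    multivariateGaussian_eq_ofDensity hSq, lintegral_ofDensity (measurable_gaussDensity _) hg,
    ← (isPosDensity_gaussDensity hSp (Real.sqrt n • m)).lintegral_eq_one]
  refine lintegral_congr fun z => ?_
  rw [← ENNReal.ofReal_mul (gaussDensity_nonneg _ _),
    mul_div_cancel₀ _ (gaussDensity_pos hSq _ _).ne']

/-- The covariance of the prior on the null whose Bayes marginal of the sufficient statistic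
agrees with that of the alternative. -/
noncomputable def matchedPrior (Sp Sq C : Matrix (Fin d) (Fin d) ℝ) (n : ℕ) :
    Matrix (Fin d) (Fin d) ℝ := C + (n : ℝ)⁻¹ • (Sq - Sp)

lemma matchedPrior_posSemidef (hC : C.PosDef) (h : (Sq - Sp).PosSemidef) (n : ℕ) :
    (matchedPrior Sp Sq C n).PosSemidef :=
  hC.posSemidef.add (h.smul (by positivity))

/-- The prior is matched so that Sp + nD = Sq + nC: Z has the same marginal in numerator and
denominator and cancels. -/
lemma bayesFactored_div_matchedPrior (hSq : Sq.PosDef) (hC : C.PosDef)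
    (hn : 1 ≤ n) (m₁ : Obs d) (u : Sample d n) :
    bayesFactored Sq m₁ C u / bayesFactored Sp m₁ (matchedPrior Sp Sq C n) u =
      condFactor Sq u / condFactor Sp u := by
  have hn0 : (n : ℝ) ≠ 0 := by positivity
  have e : Sp + (n : ℝ) • matchedPrior Sp Sq C n = Sq + (n : ℝ) • C := by
    rw [matchedPrior, smul_add, smul_smul, mul_inv_cancel₀ hn0, one_smul]
    abel
  rw [bayesFactored, bayesFactored, e, mul_div_mul_right _ _
    (gaussDensity_pos (add_smul_posDef hSq hC.posSemidef n) _ _).ne']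

/-- Because q/p is the conditional likelihood ratio, E_Q[p_m/p] is the integral of p_m times that
ratio, which is 1. The candidate is a continuous mixture of null elements, so the hull approaches it
in divergence. -/
theorem isRIPr_bayesFactored (hSp : Sp.PosDef) (hSq : Sq.PosDef) (hC : C.PosDef)
    (h : (Sq - Sp).PosSemidef) (hn : 1 ≤ n) (m₁ : Obs d) :
    IsRIPr volume (fun u : Sample d n => bayesFactored Sq m₁ C u) (nullDensities Sp n)
      fun u => bayesFactored Sp m₁ (matchedPrior Sp Sq C n) u := by
  have hD := matchedPrior_posSemidef (n := n) hC h
  have hq := isPosDensity_bayesFactored hSq hC.posSemidef hn m₁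
  have hp := isPosDensity_bayesFactored hSp hD hn m₁
  have hlq := integrable_log_bayesFactored hSq hC.posSemidef hn m₁ hSq hC.posSemidef m₁
  have hlp := integrable_log_bayesFactored hSq hC.posSemidef hn m₁ hSp hD m₁
  refine isRIPr_of_lintegral_div_le_one hq hp (isPosDensity_of_mem_nullDensities hSp) ?_
    (hlq.sub hlp) ?_
  · rintro _ ⟨m, rfl⟩
    have hm : Measurable fun u : Sample d n => ENNReal.ofReal
        (iidDensity Sp m u / bayesFactored Sp m₁ (matchedPrior Sp Sq C n) u) :=
      ((measurable_iidDensity m).div (measurable_bayesFactored m₁)).ennreal_ofReal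
    rw [lintegral_ofDensity hq.measurable hm, ← lintegral_iidDensity_mul_condFactor_div hSp hSq hn m]
    refine (lintegral_congr fun u => ?_).le
    rw [← ENNReal.ofReal_mul (hq.pos u).le, ← bayesFactored_div_matchedPrior hSq hC hn m₁]
    congr 1
    ring
  · refine iInf_klDiv_le_mixture (W := multivariateGaussian m₁ (matchedPrior Sp Sq C n)) hq hp
      (isPosDensity_iidDensity hSp) continuous_iidDensity_left (iidDensity_le hSp)
      (bayesDensity_ae_eq hSp hD hn m₁).symm ?_ hlq hlp
    intro R
    obtain ⟨B, hB⟩ := exists_exp_neg_quadForm_le hSp R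
    refine ⟨fun u => ∑ i, (quadForm Sp⁻¹ (u i) + B), integrable_finsetSum _ fun i _ => ?_,
      fun m hm u => ?_⟩
    · have h1 := integrable_quadForm_sub (S := Sq + C) Sp⁻¹ m₁ 0
      simp only [sub_zero] at h1
      rw [← map_eval_bayes hSq hC.posSemidef hn m₁ i] at h1
      exact ((integrable_map_measure (continuous_quadForm _).aestronglyMeasurable
        (measurable_pi_apply i).aemeasurable).1 h1).add (integrable_const_iff.2 (Or.inr
          (by have := hq.isProbabilityMeasure; infer_instance)))
    · rw [← Finset.sum_neg_distrib, Real.exp_sum]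
      exact Finset.prod_le_prod (fun i _ => (Real.exp_pos _).le) fun i _ => hB m hm (u i)

theorem isBayesRIPr_of_antisimple (hSp : Sp.PosDef) (hSq : Sq.PosDef) (hC : C.PosDef)
    (h : (Sq - Sp).PosSemidef) (hn : 1 ≤ n) (m₁ : Obs d) :
    IsBayesRIPr Sp Sq m₁ C fun u : Sample d n =>
      bayesFactored Sp m₁ (matchedPrior Sp Sq C n) u :=
  (isRIPr_bayesFactored hSp hSq hC h hn m₁).congr_left
    (ofDensity_bayesDensity hSq hC.posSemidef hn m₁).symm

theorem bayesRIP_ae_eq_condStat (hSp : Sp.PosDef) (hSq : Sq.PosDef) (hC : C.PosDef)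
    (h : (Sq - Sp).PosSemidef) (hn : 1 ≤ n) (m₁ a b : Obs d) {p : Sample d n → ℝ}
    (hp : IsBayesRIPr Sp Sq m₁ C p) :
    bayesRIP Sq m₁ C p =ᵐ[volume] condStat Sp Sq a b := by
  have h1 := IsRIPr.ae_eq (isPosDensity_of_mem_nullDensities hSp) (Set.range_nonempty _) hp
    (isBayesRIPr_of_antisimple hSp hSq hC h hn m₁)
  rw [ofDensity_bayesDensity hSq hC.posSemidef hn] at h1
  have h2 := (absolutelyContinuous_ofDensity (ν := volume) (measurable_bayesFactored (n := n) m₁)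
    (bayesFactored_pos hSq hC.posSemidef m₁)).ae_le h1
  filter_upwards [h2, bayesDensity_ae_eq hSq hC.posSemidef hn m₁,
    condStat_ae_eq hSp hSq hn a b] with u hu1 hu2 hu3
  rw [hu3, bayesRIP, hu1, hu2, ← bayesFactored_div_matchedPrior hSq hC hn m₁ u]
  rfl

theorem log_bayesRIP_div_condStat_ae_eq_zero (hSp : Sp.PosDef) (hSq : Sq.PosDef) (hC : C.PosDef)
    (h : (Sq - Sp).PosSemidef) (hn : 1 ≤ n) (m₁ a b : Obs d) {p : Sample d n → ℝ}
    (hp : IsBayesRIPr Sp Sq m₁ C p) :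
    (fun u => Real.log (bayesRIP Sq m₁ C p u / condStat Sp Sq a b u)) =ᵐ[volume] 0 := by
  filter_upwards [bayesRIP_ae_eq_condStat hSp hSq hC h hn m₁ a b hp,
    condStat_ae_eq hSp hSq hn a b] with u hu1 hu2
  have h0 : condStat Sp Sq a b u ≠ 0 := by
    rw [hu2]; exact (div_pos (condFactor_pos hSq u) (condFactor_pos hSp u)).ne'
  rw [hu1, div_self h0, Real.log_one, Pi.zero_apply]

end GaussTest

theorem mainTheorem6 (d : ℕ) (Sp Sq : Matrix (Fin d) (Fin d) ℝ)
    (hSp : Sp.PosDef) (hSq : Sq.PosDef) (hne : Sq ≠ Sp)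
    (μs : GaussTest.Obs d)
    (n₀ : ℝ) (hn₀ : 0 < n₀) (x₀ : GaussTest.Obs d)
    (μ₁ : GaussTest.Obs d) (C : Matrix (Fin d) (Fin d) ℝ) (hC : C.PosDef)
    (a b : GaussTest.Obs d) :
    -- e-power of the conditional e-variable
    ((∃ ε : ℝ, 0 < ε ∧ ∀ n : ℕ, 1 < n →
        Integrable (fun u => Real.log (GaussTest.condStat Sp Sq a b u))
          (GaussTest.iidLaw Sq μs n) ∧
        (n : ℝ) * ε < ∫ u, Real.log (GaussTest.condStat Sp Sq a b u)
          ∂(GaussTest.iidLaw Sq μs n))) ∧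
    -- the two universal inference e-variables
    ((∀ n : ℕ, 1 ≤ n →
        Integrable (fun u => Real.log (GaussTest.bayesUI Sp Sq μ₁ C u /
          GaussTest.plugInUI Sp Sq n₀ x₀ u)) (GaussTest.iidLaw Sq μs n)) ∧
      (fun n : ℕ => ∫ u, Real.log (GaussTest.bayesUI Sp Sq μ₁ C u /
          GaussTest.plugInUI Sp Sq n₀ x₀ u) ∂(GaussTest.iidLaw Sq μs n))
        =O[atTop] (fun _ => (1 : ℝ))) ∧
    -- conditional e-variable against plug-in universal inference
    ((∀ n : ℕ, 1 ≤ n →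
        Integrable (fun u => Real.log (GaussTest.condStat Sp Sq a b u /
          GaussTest.plugInUI Sp Sq n₀ x₀ u)) (GaussTest.iidLaw Sq μs n)) ∧
      (fun n : ℕ => (∫ u, Real.log (GaussTest.condStat Sp Sq a b u /
          GaussTest.plugInUI Sp Sq n₀ x₀ u) ∂(GaussTest.iidLaw Sq μs n))
          - (d : ℝ) / 2 * Real.log n)
        =O[atTop] (fun _ => (1 : ℝ))) ∧
    -- simple case: sequential RIPr against plug-in universal inference
    ((Sp - Sq).PosSemidef →
      (∃ p, GaussTest.IsSeqRIPr Sp Sq n₀ x₀ p) ∧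
      (∀ p, GaussTest.IsSeqRIPr Sp Sq n₀ x₀ p →
        (∀ n : ℕ, 1 ≤ n →
          Integrable (fun u => Real.log (GaussTest.seqRIP Sq n₀ x₀ p u /
            GaussTest.plugInUI Sp Sq n₀ x₀ u)) (GaussTest.iidLaw Sq μs n)) ∧
        (fun n : ℕ => (∫ u, Real.log (GaussTest.seqRIP Sq n₀ x₀ p u /
            GaussTest.plugInUI Sp Sq n₀ x₀ u) ∂(GaussTest.iidLaw Sq μs n))
            - GaussTest.effDim Sq Sp / 2 * Real.log n)
          =O[atTop] (fun _ => (1 : ℝ))) ∧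
      GaussTest.effDim Sq Sp ≤ d) ∧
    -- strict simple case
    ((Sp - Sq).PosDef → GaussTest.effDim Sq Sp < d) ∧
    -- anti-simple case
    ((Sq - Sp).PosSemidef →
      (∃ p, GaussTest.IsSeqRIPr Sp Sq n₀ x₀ p) ∧
      (∀ p, GaussTest.IsSeqRIPr Sp Sq n₀ x₀ p → ∀ n : ℕ, 1 ≤ n →
        Integrable (fun u => Real.log (GaussTest.seqRIP Sq n₀ x₀ p u))
          (GaussTest.iidLaw Sq μs n) ∧
        ∫ u, Real.log (GaussTest.seqRIP Sq n₀ x₀ p u) ∂(GaussTest.iidLaw Sq μs n) = 0) ∧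
      (∀ n : ℕ, 1 ≤ n →
        (∃ p : GaussTest.Sample d n → ℝ, GaussTest.IsBayesRIPr Sp Sq μ₁ C p) ∧
        (∀ p : GaussTest.Sample d n → ℝ, GaussTest.IsBayesRIPr Sp Sq μ₁ C p →
          GaussTest.bayesRIP Sq μ₁ C p =ᵐ[GaussTest.iidLaw Sq μs n]
            GaussTest.condStat Sp Sq a b ∧
          Integrable (fun u => Real.log (GaussTest.bayesRIP Sq μ₁ C p u /
            GaussTest.condStat Sp Sq a b u)) (GaussTest.iidLaw Sq μs n) ∧
          ∫ u, Real.log (GaussTest.bayesRIP Sq μ₁ C p u /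
            GaussTest.condStat Sp Sq a b u) ∂(GaussTest.iidLaw Sq μs n) = 0))) := by
  -- In dimension 0 all matrices coincide, so Sq ≠ Sp forces d ≥ 1, which the strict trace
  -- inequality needs.
  have hnonempty : Nonempty (Fin d) := by
    by_contra hd
    rw [not_nonempty_iff] at hd
    exact hne (Subsingleton.elim _ _)
  refine ⟨GaussTest.condStat_power hSp hSq hne μs a b,
    GaussTest.bayesUI_asymptotics hSp hSq hC μs μ₁ hn₀ x₀,
    GaussTest.condStat_div_plugInUI_asymptotics hSp hSq μs a b hn₀ x₀,
    fun h => ⟨⟨_, GaussTest.isSeqRIPr_of_simple hSp hSq h n₀ x₀⟩,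
      fun p hp => GaussTest.seqRIP_simple_asymptotics hSp hSq h μs hn₀ x₀ p hp,
      GaussTest.effDim_le hSp h⟩,
    fun h => GaussTest.effDim_lt hSp h,
    fun h => ⟨⟨_, GaussTest.isSeqRIPr_of_antisimple hSp hSq h n₀ x₀⟩, fun p hp n _ => ?_,
      fun n hn => ⟨⟨_, GaussTest.isBayesRIPr_of_antisimple hSp hSq hC h hn μ₁⟩, fun p hp => ?_⟩⟩⟩
  · have h0 := GaussTest.log_seqRIP_ae_eq_zero_of_antisimple hSp hSq h μs hp n
    exact ⟨(integrable_zero _ _ _).congr h0.symm, by rw [integral_congr_ae h0]; simp⟩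
  · have hac := GaussTest.iidLaw_absolutelyContinuous_volume hSq μs n
    have h0 := hac.ae_eq
      (GaussTest.log_bayesRIP_div_condStat_ae_eq_zero hSp hSq hC h hn μ₁ a b hp)
    exact ⟨hac.ae_eq (GaussTest.bayesRIP_ae_eq_condStat hSp hSq hC h hn μ₁ a b hp),
      (integrable_zero _ _ _).congr h0.symm, by rw [integral_congr_ae h0]; simp⟩
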